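/- Let $G=(V,E)$ be a finite undirected multigraph (parallel edges are allowed), let $k\ge 1$, and suppose that $G$ is $k$-edge-connected, that is, any two distinct vertices of $G$ are joined by $k$ pairwise edge-disjoint paths. Let $\vec G$ be the directed multigraph on $V$ that contains, for every edge $e=\{x,y\}\in E$, both arcs $(x,y)$ and $(y,x)$ along $e$ (so that parallel edges give different arcs). For $d\in V$, a $d$-rooted spanning arborescence of $\vec G$ is a subgraph of $\vec G$ with vertex set $V$ in which $d$ is the only vertex without outgoing arcs and in which every other vertex has exactly one directed walk to $d$. Two arborescences are arc-disjoint if they have no arc in common; two arc-disjoint arborescences share an edge $e=\{x,y\}$ if one of them contains the arc $(x,y)$ along $e$ and the other contains the arc $(y,x)$ along $e$. Then, for every vertex $d\in V$, there are $k$ pairwise arc-disjoint $d$-rooted spanning arborescences $T_1,\dots,T_k$ of $\vec G$ such that no two of $T_1,\dots,T_{\lfloor k/2\rfloor}$ share an edge and no two of $T_{\lfloor k/2\rfloor+1},\dots,T_{2\lfloor k/2\rfloor}$ share an edge. -/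

import Mathlib

namespace Graph

/-- A directed arc from `tail` to `head` along the edge `edge`.  The edge is recorded because
multigraphs may have several parallel edges, which give rise to different arcs. -/
@[ext]
structure Arc (α β : Type*) where
  edge : β
  tail : α
  head : α

/-- The opposite arc `(y, x)` of an arc `(x, y)`, along the same edge. -/
def Arc.reverse {α β : Type*} (a : Arc α β) : Arc α β :=
  ⟨a.edge, a.head, a.tail⟩

/-- The arcs of the directed copy of `G`: every edge `{x, y}` gives both arcs
`(x, y)` and `(y, x)`. -/
def arcSet {α β : Type*} (G : Graph α β) : Set (Arc α β) :=
  {a | G.IsLink a.edge a.tail a.head}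

/-- `IsDiWalk A x p y`: the list of arcs `p` is a directed walk from `x` to `y`, all of whose arcs
lie in the set `A`. -/
def IsDiWalk {α β : Type*} (A : Set (Arc α β)) : α → List (Arc α β) → α → Prop
  | x, [], y => x = y
  | x, a :: p, y => a ∈ A ∧ a.tail = x ∧ IsDiWalk A a.head p y

/-- `p` is a path of the undirected multigraph `G` from `x` to `y`: a walk that traverses edges of
`G` (each in one of its two directions) and visits no vertex twice. -/
def IsPathBetween {α β : Type*} (G : Graph α β) (x : α) (p : List (Arc α β)) (y : α) : Prop :=
  IsDiWalk G.arcSet x p y ∧ (x :: p.map Arc.head).Nodup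

/-- `G` is `k`-edge-connected: any two vertices are joined by `k` pairwise edge-disjoint paths. -/
def IsEdgeConnected {α β : Type*} (G : Graph α β) (k : ℕ) : Prop :=
  ∀ x ∈ G.vertexSet, ∀ y ∈ G.vertexSet, x ≠ y →
    ∃ P : Fin k → List (Arc α β),
      (∀ i, G.IsPathBetween x (P i) y) ∧
      ∀ i j, i ≠ j → List.Disjoint ((P i).map Arc.edge) ((P j).map Arc.edge)

/-- A subgraph of the directed copy of `G`. -/
structure DiSubgraph {α β : Type*} (G : Graph α β) where
  verts : Set α
  arcs : Set (Arc α β)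
  verts_subset : verts ⊆ G.vertexSet
  arcs_subset : arcs ⊆ G.arcSet
  tail_mem : ∀ a ∈ arcs, a.tail ∈ verts
  head_mem : ∀ a ∈ arcs, a.head ∈ verts

/-- `T` is an `r`-rooted arborescence: `r` is the only vertex of `T` without outgoing arcs, and
from every other vertex of `T` there is exactly one directed walk in `T` to `r`. (Uniqueness is
required among all walks, so that `T` has no directed cycles; with uniqueness only among walks
without repeated vertices, directed cycles would not be excluded.) -/
def DiSubgraph.IsArborescence {α β : Type*} {G : Graph α β} (T : G.DiSubgraph) (r : α) : Prop :=
  r ∈ T.verts ∧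
  (∀ v ∈ T.verts, (∀ a ∈ T.arcs, a.tail ≠ v) ↔ v = r) ∧
  ∀ v ∈ T.verts, v ≠ r → ∃! p : List (Arc α β), IsDiWalk T.arcs v p r

/-- `T` is an `r`-rooted spanning arborescence of the directed copy of `G`. -/
def DiSubgraph.IsSpanningArborescence {α β : Type*} {G : Graph α β} (T : G.DiSubgraph) (r : α) :
    Prop :=
  T.IsArborescence r ∧ T.verts = G.vertexSet

/-- `T₁` and `T₂` have no arc in common. -/
def DiSubgraph.ArcDisjoint {α β : Type*} {G : Graph α β} (T₁ T₂ : G.DiSubgraph) : Prop :=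
  ∀ a ∈ T₁.arcs, a ∉ T₂.arcs

/-- Two arc-disjoint `T₁` and `T₂` share no edge: if `T₁` uses an edge in one direction, then `T₂`
does not use the same edge in the opposite direction. -/
def DiSubgraph.ShareNoEdge {α β : Type*} {G : Graph α β} (T₁ T₂ : G.DiSubgraph) : Prop :=
  ∀ a ∈ T₁.arcs, a.reverse ∉ T₂.arcs

end Graph

/-! Connectivity enters only through cuts: every nonempty proper vertex set is left by at least k
edges (`CutCondition`). Put m = ⌊k/2⌋. The arborescences are m of each of two kinds and, if k is
odd, one more, indexed by `none`. To keep those of one kind from sharing edges, every edge carries a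
direction in which the first kind may use it, and the second kind may use it only in the opposite
direction; `none` is not restricted.

The proof is by induction on vertices plus edges. Edges whose deletion preserves the cut condition
are deleted, so that every remaining edge crosses a tight set, i.e. a set avoiding d that is left by
exactly k edges. Uncrossing then yields a vertex z ≠ d of degree k.

If k = 2m, Lovász' splitting lemma (`exists_split`) replaces the edges at z by m edges between other
vertices, preserving the cut condition. The smaller graph has its arborescences by induction, and z
is put back by pinching these m edges together (`exists_pinch`). Each of them is used by at most one
forest of each kind. A forest that now runs through z, perhaps several times, leaves z towards the
head of lowest rank among the pinched arcs it used; the remaining halves are distributed among the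
other forests of its kind (`exists_choice`).

If k = 2m + 1, one edge g = zw is set aside before z is split off. Tight sets are now laminar, so g
can be chosen such that it crosses only singletons among them (`exists_edge_tight_singleton`). After
pinching, exactly one forest lacks an arc at z, since `none` may take one from another forest, and
the deprived forest does not enter z. If {w} is not tight, setting g aside does no harm to the cuts
away from z, and g supplies the missing arc. If {w} is tight, w is split off as well, and two arcs
are missing, one at z and one at w. They are supplied by the two directions of g, combined with
exchanges of arcs between forests (`exists_complete_of_two_missing`); for some of these a forest
without arcs between z and w is needed, which exists because z and w are joined by at most m edges.
-/

/-- A multigraph with finitely many labelled edges, each edge being listed with its two ends in an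
arbitrary order. -/
structure FinMultigraph (α β : Type*) where
  edges : Finset β
  fst : β → α
  snd : β → α

namespace FinMultigraph

set_option linter.unusedSectionVars false

variable {α β : Type*} [DecidableEq α] [DecidableEq β]

/-- `M.Links e u v`: the ends of the edge `e` of `M` are `u` and `v`. -/
def Links (M : FinMultigraph α β) (e : β) (u v : α) : Prop :=
  e ∈ M.edges ∧ (M.fst e = u ∧ M.snd e = v ∨ M.fst e = v ∧ M.snd e = u)

theorem Links.symm {M : FinMultigraph α β} {e : β} {u v : α} (h : M.Links e u v) :
    M.Links e v u :=
  ⟨h.1, h.2.symm⟩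

theorem Links.eq_or_eq {M : FinMultigraph α β} {e : β} {u v x y : α} (h : M.Links e u v)
    (h' : M.Links e x y) : u = x ∧ v = y ∨ u = y ∧ v = x := by
  obtain ⟨-, h⟩ := h
  obtain ⟨-, h'⟩ := h'
  grind

/-! ### Cut functions and their inequalities -/

/-- `1` if exactly one of `u`, `v` lies in `X`, and `0` otherwise. -/
def cross (u v : α) (X : Finset α) : ℕ := if (u ∈ X ↔ v ∈ X) then 0 else 1

/-- The number of edges of `M` with exactly one end in `X`. -/
def cut (M : FinMultigraph α β) (X : Finset α) : ℕ :=
  ∑ e ∈ M.edges, cross (M.fst e) (M.snd e) X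

/-- The number of edges of `M` between `z` and `X`. -/
def inc (M : FinMultigraph α β) (z : α) (X : Finset α) : ℕ :=
  ∑ e ∈ M.edges, if (M.fst e = z ∧ M.snd e ∈ X) ∨ (M.snd e = z ∧ M.fst e ∈ X) then 1 else 0

theorem cut_inter_add_cut_union_le (M : FinMultigraph α β) (X Y : Finset α) :
    M.cut (X ∩ Y) + M.cut (X ∪ Y) ≤ M.cut X + M.cut Y := by
  simp only [cut, ← Finset.sum_add_distrib]
  refine Finset.sum_le_sum fun e _ => ?_
  simp only [cross, Finset.mem_inter, Finset.mem_union]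
  grind

theorem cut_sdiff_add_cut_sdiff_le (M : FinMultigraph α β) (X Y : Finset α) :
    M.cut (X \ Y) + M.cut (Y \ X) ≤ M.cut X + M.cut Y := by
  simp only [cut, ← Finset.sum_add_distrib]
  refine Finset.sum_le_sum fun e _ => ?_
  simp only [cross, Finset.mem_sdiff]
  grind

/-- Here q counts the edges between X and Y. Only the parity of the difference matters later. -/
theorem exists_cut_union_add (M : FinMultigraph α β) {X Y : Finset α} (h : Disjoint X Y) :
    ∃ q, M.cut X + M.cut Y = M.cut (X ∪ Y) + 2 * q := by
  refine ⟨∑ e ∈ M.edges, if (M.fst e ∈ X ∧ M.snd e ∈ Y) ∨ (M.fst e ∈ Y ∧ M.snd e ∈ X)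
    then 1 else 0, ?_⟩
  simp only [cut, Finset.mul_sum, ← Finset.sum_add_distrib]
  refine Finset.sum_congr rfl fun e _ => ?_
  have h1 : ∀ u ∈ X, u ∉ Y := fun u hu => Finset.disjoint_left.1 h hu
  simp only [cross, Finset.mem_union]
  grind

/-- The inequality holds edge by edge. The edge e runs from outside all three sets into their common
part, so it counts once on the left and three times on the right; this is the surplus 2. -/
theorem cut_three (M : FinMultigraph α β) {X Y Z : Finset α} {e : β} {z t : α}
    (he : M.Links e z t) (hX : t ∈ X) (hY : t ∈ Y) (hZ : t ∈ Z)
    (hzX : z ∉ X) (hzY : z ∉ Y) (hzZ : z ∉ Z) :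
    M.cut (X ∩ Y ∩ Z) + M.cut (X \ (Y ∪ Z)) + M.cut (Y \ (X ∪ Z)) + M.cut (Z \ (X ∪ Y)) + 2 ≤
      M.cut X + M.cut Y + M.cut Z := by
  have h2 : (2 : ℕ) = ∑ e' ∈ M.edges, if e' = e then 2 else 0 := by
    simp [Finset.sum_ite_eq', he.1]
  rw [h2]
  simp only [cut, ← Finset.sum_add_distrib]
  refine Finset.sum_le_sum fun e' _ => ?_
  simp only [cross, Finset.mem_inter, Finset.mem_union, Finset.mem_sdiff]
  by_cases h : e' = e
  · subst h
    rcases he.2 with ⟨h1, h2⟩ | ⟨h1, h2⟩ <;> simp [h1, h2, hX, hY, hZ, hzX, hzY, hzZ]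
  · simp only [h, if_false]
    by_cases h1 : M.fst e' ∈ X <;> by_cases h2 : M.fst e' ∈ Y <;> by_cases h3 : M.fst e' ∈ Z <;>
      by_cases h4 : M.snd e' ∈ X <;> by_cases h5 : M.snd e' ∈ Y <;>
      by_cases h6 : M.snd e' ∈ Z <;> simp [h1, h2, h3, h4, h5, h6]

theorem cut_add_inc_sdiff (M : FinMultigraph α β) {V X : Finset α} {z : α} (hz : z ∉ V)
    (hM : ∀ e ∈ M.edges, M.fst e ∈ insert z V ∧ M.snd e ∈ insert z V) (hX : X ⊆ V) :
    M.cut X + M.inc z (V \ X) = M.cut (V \ X) + M.inc z X := by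
  simp only [cut, inc, ← Finset.sum_add_distrib]
  refine Finset.sum_congr rfl fun e he => ?_
  obtain ⟨h1, h2⟩ := hM e he
  have h3 := @hX (M.fst e)
  have h4 := @hX (M.snd e)
  have h5 : z ∉ X := fun h => hz (hX h)
  simp only [cross, Finset.mem_sdiff, Finset.mem_insert] at *
  grind

theorem inc_add_inc_sdiff (M : FinMultigraph α β) {V X : Finset α} {z : α} (hz : z ∉ V)
    (hM : ∀ e ∈ M.edges, M.fst e ∈ insert z V ∧ M.snd e ∈ insert z V) (hX : X ⊆ V) :
    M.inc z X + M.inc z (V \ X) = M.cut {z} := by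
  simp only [cut, inc, ← Finset.sum_add_distrib]
  refine Finset.sum_congr rfl fun e he => ?_
  obtain ⟨h1, h2⟩ := hM e he
  have h3 := @hX (M.fst e)
  have h4 := @hX (M.snd e)
  have h5 : z ∉ X := fun h => hz (hX h)
  simp only [cross, Finset.mem_sdiff, Finset.mem_insert, Finset.mem_singleton] at *
  grind

/-- Strictness comes from e, which is counted for both X and Y. -/
theorem cut_singleton_lt_inc_add_inc (M : FinMultigraph α β) {X Y : Finset α} {z t : α} {e : β}
    (he : M.Links e z t) (hX : t ∈ X) (hY : t ∈ Y) (hzX : z ∉ X) (hzY : z ∉ Y)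
    (hcov : ∀ f u, M.Links f z u → u ≠ z → u ∈ X ∨ u ∈ Y) :
    M.cut {z} < M.inc z X + M.inc z Y := by
  simp only [cut, inc, ← Finset.sum_add_distrib]
  have key : ∀ f ∈ M.edges, cross (M.fst f) (M.snd f) {z} ≤
      (if (M.fst f = z ∧ M.snd f ∈ X) ∨ (M.snd f = z ∧ M.fst f ∈ X) then 1 else 0) +
      (if (M.fst f = z ∧ M.snd f ∈ Y) ∨ (M.snd f = z ∧ M.fst f ∈ Y) then 1 else 0) := by
    intro f hf
    have h1 := hcov f (M.snd f)
    have h2 := hcov f (M.fst f)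
    simp only [cross, Links, Finset.mem_singleton] at *
    grind
  refine Finset.sum_lt_sum key ⟨e, he.1, ?_⟩
  have : t ≠ z := by rintro rfl; exact hzX hX
  rcases he.2 with ⟨h1, h2⟩ | ⟨h1, h2⟩ <;> simp [h1, h2, hX, hY, cross, this]

/-! ### Splitting off the edges at a vertex -/

/-- Splitting off: the edges `e`, with an end `a`, and `f`, with an end `b`, are replaced by an edge
between `a` and `b`, which inherits the label `e`. -/
def split (M : FinMultigraph α β) (e f : β) (a b : α) : FinMultigraph α β where
  edges := M.edges.erase f
  fst := Function.update M.fst e a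
  snd := Function.update M.snd e b

theorem cross_comm (u v : α) (X : Finset α) : cross u v X = cross v u X := by
  simp [cross, iff_comm]

theorem Links.cross_eq {M : FinMultigraph α β} {e : β} {u v : α} (h : M.Links e u v)
    (X : Finset α) : cross (M.fst e) (M.snd e) X = cross u v X := by
  rcases h.2 with ⟨rfl, rfl⟩ | ⟨rfl, rfl⟩
  · rfl
  · exact cross_comm _ _ _

theorem cut_split (M : FinMultigraph α β) {e f : β} {a b z : α} (hef : e ≠ f)
    (he : M.Links e z a) (hf : M.Links f z b) (X : Finset α) :
    (M.split e f a b).cut X + cross z a X + cross z b X = M.cut X + cross a b X := by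
  have h1 : e ∈ M.edges.erase f := Finset.mem_erase.2 ⟨hef, he.1⟩
  simp only [cut, split]
  rw [← Finset.add_sum_erase M.edges _ hf.1, ← Finset.add_sum_erase _ _ h1,
    ← Finset.add_sum_erase (M.edges.erase f) _ h1, he.cross_eq, hf.cross_eq]
  have : ∀ e' ∈ (M.edges.erase f).erase e,
      cross (Function.update M.fst e a e') (Function.update M.snd e b e') X =
      cross (M.fst e') (M.snd e') X := by
    intro e' he'
    have := (Finset.mem_erase.1 he').1
    simp [Function.update_of_ne this]
  rw [Finset.sum_congr rfl this]
  simp only [Function.update_self]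
  ring

theorem cut_le_cut_split (M : FinMultigraph α β) {e f : β} {a b z : α} (hef : e ≠ f)
    (he : M.Links e z a) (hf : M.Links f z b) (X : Finset α) (hX : z ∉ X) :
    (M.split e f a b).cut X + (if a ∈ X ∧ b ∈ X then 2 else 0) = M.cut X := by
  have := M.cut_split hef he hf X
  simp only [cross] at this
  grind

/-- **Lovász' splitting lemma.** -/
theorem exists_split (M : FinMultigraph α β) {V : Finset α} {z : α} (hz : z ∉ V)
    (hM : ∀ e ∈ M.edges, M.fst e ∈ insert z V ∧ M.snd e ∈ insert z V) (k : ℕ) (R : Finset α → ℕ)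
    (hRk : ∀ X, R X ≤ k) (hRc : ∀ X ⊆ V, R (V \ X) = R X)
    (hR4 : ∀ A B C D : Finset α, A ⊆ V → B ⊆ V → C ⊆ V → D ⊆ V →
      A.Nonempty → B.Nonempty → C.Nonempty → D.Nonempty →
      Disjoint A B → Disjoint A C → Disjoint A D → Disjoint B C → Disjoint B D → Disjoint C D →
      3 * k + 1 < R A + R B + R C + R D)
    (hcut : ∀ X ⊆ V, X.Nonempty → X ≠ V → R X ≤ M.cut X)
    (hev : Even (M.cut {z})) {e : β} {t : α} (he : M.Links e z t) (ht : t ∈ V) :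
    ∃ f u, f ≠ e ∧ M.Links f z u ∧ u ∈ V ∧
      ∀ X ⊆ V, X.Nonempty → X ≠ V → R X ≤ (M.split e f t u).cut X := by
  by_contra! hcon
  have hzn : ∀ X ⊆ V, z ∉ X := fun X hX h => hz (hX h)
  -- Splitting e with f lowers only the cuts of sets containing both t and u, and lowers these by 2.
  -- So failure produces a dangerous set, whose cut exceeds its bound by at most 1.
  have hdang : ∀ f u, M.Links f z u → u ∈ V → ∃ X ⊆ V, X ≠ V ∧ t ∈ X ∧ u ∈ X ∧
      M.cut X ≤ R X + 1 := by
    have aux : ∀ f u, f ≠ e → M.Links f z u → u ∈ V → ∃ X ⊆ V, X ≠ V ∧ t ∈ X ∧ u ∈ X ∧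
        M.cut X ≤ R X + 1 := by
      intro f u hfe hf hu
      obtain ⟨X, hXV, hXn, hXne, hlt⟩ := hcon f u hfe hf hu
      have h1 := M.cut_le_cut_split hfe.symm he hf X (hzn X hXV)
      have h2 := hcut X hXV hXn hXne
      have h3 : t ∈ X ∧ u ∈ X := by
        by_contra h
        rw [if_neg h] at h1
        omega
      rw [if_pos h3] at h1
      exact ⟨X, hXV, hXne, h3.1, h3.2, by omega⟩
    intro f u hf hu
    by_cases hfe : f = e
    · subst hfe
      have hut : u = t := by
        rcases hf.eq_or_eq he with h | h
        · exact h.2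
        · exact absurd (h.1 ▸ ht) hz
      subst hut
      by_contra! hno
      -- another edge at `z` exists, by parity
      have : ∃ f' ∈ M.edges, f' ≠ f ∧ cross (M.fst f') (M.snd f') {z} ≠ 0 := by
        by_contra! hall
        have h1 : M.cut {z} = 1 := by
          rw [cut, ← Finset.add_sum_erase _ _ hf.1, hf.cross_eq,
            Finset.sum_eq_zero fun x hx => hall x (Finset.mem_of_mem_erase hx)
              (Finset.mem_erase.1 hx).1]
          have : u ≠ z := by rintro rfl; exact hz ht
          simp [cross, this]
        rw [h1] at hev
        exact absurd hev (by decide)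
      obtain ⟨f', hf', hne, hc⟩ := this
      have hends := hM f' hf'
      have : ∃ u', M.Links f' z u' ∧ u' ∈ V := by
        simp only [cross, Finset.mem_singleton, Finset.mem_insert] at hc hends
        by_cases h1 : M.fst f' = z
        · exact ⟨M.snd f', ⟨hf', Or.inl ⟨h1, rfl⟩⟩, by grind⟩
        · exact ⟨M.fst f', ⟨hf', Or.inr ⟨rfl, by grind⟩⟩, by grind⟩
      obtain ⟨u', hu', hu'V⟩ := this
      obtain ⟨X, h1, h2, h3, h4, h5⟩ := aux f' u' hne hu' hu'V
      exact absurd h5 (not_le.2 (hno X h1 h2 h3 h3))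
    · exact aux f u hfe hf hu
  -- The complement in V obeys the same bound, so X has at most one more edge to z than its
  -- complement has. Since the degree of z is even, X receives at most half of the edges at z.
  have hhalf : ∀ X ⊆ V, X ≠ V → t ∈ X → M.cut X ≤ R X + 1 → 2 * M.inc z X ≤ M.cut {z} := by
    intro X hX hne htX hc
    have h1 := M.cut_add_inc_sdiff hz hM hX
    have h2 := M.inc_add_inc_sdiff hz hM hX
    have h3 : R X ≤ M.cut (V \ X) := by
      rw [← hRc X hX]
      refine hcut _ Finset.sdiff_subset ?_ ?_
      · rw [Finset.sdiff_nonempty]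
        exact fun h => hne (hX.antisymm h)
      · intro h
        have := h ▸ ht
        exact (Finset.mem_sdiff.1 this).2 htX
    obtain ⟨c, hc'⟩ := hev
    omega
  -- Families of dangerous sets covering all neighbours of z in V. In one of minimum size every
  -- member has a private element.
  let Q : Finset (Finset α) → Prop := fun 𝒞 =>
    (∀ X ∈ 𝒞, X ⊆ V ∧ X ≠ V ∧ t ∈ X ∧ M.cut X ≤ R X + 1) ∧
      ∀ f u, M.Links f z u → u ∈ V → ∃ X ∈ 𝒞, u ∈ X
  have hQ : ∃ n, ∃ 𝒞, Q 𝒞 ∧ 𝒞.card = n := by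
    refine ⟨_, V.powerset.filter fun X => X ≠ V ∧ t ∈ X ∧ M.cut X ≤ R X + 1, ⟨?_, ?_⟩, rfl⟩
    · intro X hX
      simpa using hX
    · intro f u hf hu
      obtain ⟨X, h1, h2, h3, h4, h5⟩ := hdang f u hf hu
      exact ⟨X, by simp [h1, h2, h3, h5], h4⟩
  classical
  obtain ⟨𝒞, ⟨h𝒞, hcov⟩, hcard⟩ := Nat.find_spec hQ
  have hmin : ∀ 𝒞', Q 𝒞' → 𝒞.card ≤ 𝒞'.card := fun 𝒞' h' =>
    hcard ▸ Nat.find_min' hQ ⟨𝒞', h', rfl⟩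
  have hpriv : ∀ X ∈ 𝒞, ∃ u ∈ X, ∀ Y ∈ 𝒞, Y ≠ X → u ∉ Y := by
    intro X hX
    by_contra! hno
    have := hmin (𝒞.erase X) ⟨fun Y hY => h𝒞 Y (Finset.mem_of_mem_erase hY), ?_⟩
    · rw [Finset.card_erase_of_mem hX] at this
      have := Finset.card_pos.2 ⟨X, hX⟩
      omega
    · intro f u hf hu
      obtain ⟨Y, hY, huY⟩ := hcov f u hf hu
      by_cases hYX : Y = X
      · subst hYX
        obtain ⟨Y', h1, h2, h3⟩ := hno u huY
        exact ⟨Y', Finset.mem_erase.2 ⟨h2, h1⟩, h3⟩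
      · exact ⟨Y, Finset.mem_erase.2 ⟨hYX, hY⟩, huY⟩
  -- Two members cannot cover: each receives at most half of the edges at z, and e is counted twice.
  have htwo : ∀ X ∈ 𝒞, ∀ Y ∈ 𝒞, ∃ Z ∈ 𝒞, Z ≠ X ∧ Z ≠ Y := by
    intro X hX Y hY
    by_contra! hno
    obtain ⟨hX1, hX2, hX3, hX4⟩ := h𝒞 X hX
    obtain ⟨hY1, hY2, hY3, hY4⟩ := h𝒞 Y hY
    have h1 := M.cut_singleton_lt_inc_add_inc he hX3 hY3 (hzn X hX1) (hzn Y hY1) (by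
      intro f u hf hu
      have huV : u ∈ V := by
        have := hM f hf.1
        simp only [Finset.mem_insert] at this
        rcases hf.2 with ⟨h1, h2⟩ | ⟨h1, h2⟩ <;> grind
      obtain ⟨Z, hZ, huZ⟩ := hcov f u hf huV
      by_cases h : Z = X
      · exact Or.inl (h ▸ huZ)
      · exact Or.inr (hno Z hZ h ▸ huZ))
    have h2 := hhalf X hX1 hX2 hX3 hX4
    have h3 := hhalf Y hY1 hY2 hY3 hY4
    omega
  obtain ⟨X, hX, -⟩ := hcov e t he ht
  obtain ⟨Y, hY, hYX, -⟩ := htwo X hX X hX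
  obtain ⟨Z, hZ, hZX, hZY⟩ := htwo X hX Y hY
  obtain ⟨hX1, hX2, hX3, hX4⟩ := h𝒞 X hX
  obtain ⟨hY1, hY2, hY3, hY4⟩ := h𝒞 Y hY
  obtain ⟨hZ1, hZ2, hZ3, hZ4⟩ := h𝒞 Z hZ
  obtain ⟨x, hx, hx'⟩ := hpriv X hX
  obtain ⟨y, hy, hy'⟩ := hpriv Y hY
  obtain ⟨w, hw, hw'⟩ := hpriv Z hZ
  have hA : (X ∩ Y ∩ Z).Nonempty := ⟨t, by simp [hX3, hY3, hZ3]⟩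
  have hB : (X \ (Y ∪ Z)).Nonempty := ⟨x, by simp [hx, hx' Y hY hYX, hx' Z hZ hZX]⟩
  have hC : (Y \ (X ∪ Z)).Nonempty := ⟨y, by simp [hy, hy' X hX hYX.symm, hy' Z hZ hZY]⟩
  have hD : (Z \ (X ∪ Y)).Nonempty := ⟨w, by simp [hw, hw' X hX hZX.symm, hw' Y hY hZY.symm]⟩
  have sA : X ∩ Y ∩ Z ⊆ V := fun u hu => hX1 (Finset.mem_inter.1 (Finset.mem_inter.1 hu).1).1
  have sB : X \ (Y ∪ Z) ⊆ V := Finset.sdiff_subset.trans hX1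
  have sC : Y \ (X ∪ Z) ⊆ V := Finset.sdiff_subset.trans hY1
  have sD : Z \ (X ∪ Y) ⊆ V := Finset.sdiff_subset.trans hZ1
  -- The common part and the three private parts are nonempty and disjoint. Their cuts sum to at
  -- most (3k + 3) - 2 = 3k + 1 by `cut_three`, which contradicts the bound on four disjoint sets.
  have h4 := hR4 _ _ _ _ sA sB sC sD hA hB hC hD
    (by rw [Finset.disjoint_left]; intro u; simp; tauto)
    (by rw [Finset.disjoint_left]; intro u; simp; tauto)
    (by rw [Finset.disjoint_left]; intro u; simp; tauto)
    (by rw [Finset.disjoint_left]; intro u; simp; tauto)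
    (by rw [Finset.disjoint_left]; intro u; simp; tauto)
    (by rw [Finset.disjoint_left]; intro u; simp; tauto)
  have h5 := M.cut_three he hX3 hY3 hZ3 (hzn X hX1) (hzn Y hY1) (hzn Z hZ1)
  have neA : X ∩ Y ∩ Z ≠ V := fun h => hX2 (hX1.antisymm fun u hu => by
    rw [← h] at hu; exact (Finset.mem_inter.1 (Finset.mem_inter.1 hu).1).1)
  have neB : X \ (Y ∪ Z) ≠ V := fun h => by have := h ▸ ht; simp [hX3, hY3] at this
  have neC : Y \ (X ∪ Z) ≠ V := fun h => by have := h ▸ ht; simp [hX3, hY3] at this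
  have neD : Z \ (X ∪ Y) ≠ V := fun h => by have := h ▸ ht; simp [hX3, hY3] at this
  have := hcut _ sA hA neA
  have := hcut _ sB hB neB
  have := hcut _ sC hC neC
  have := hcut _ sD hD neD
  have := hRk X
  have := hRk Y
  have := hRk Z
  omega

/-- All ends of edges of `M` lie in `V`. -/
def EndsIn (M : FinMultigraph α β) (V : Finset α) : Prop :=
  ∀ e ∈ M.edges, M.fst e ∈ V ∧ M.snd e ∈ V

/-- `H`, on the vertex set `V`, arises from `M` by splitting off all the edges at `z` in pairs: the
edge `e ∈ P` of `H` replaces the edges `e` and `f e` of `M`. -/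
structure IsCompleteSplitting (M H : FinMultigraph α β) (V : Finset α) (z : α) (P : Finset β)
    (f : β → β) : Prop where
  subset : P ⊆ H.edges
  edges_subset : H.edges ⊆ M.edges
  endsIn : H.EndsIn V
  two_mul_card : 2 * P.card = M.cut {z}
  fst_eq : ∀ e ∈ H.edges, e ∉ P → H.fst e = M.fst e
  snd_eq : ∀ e ∈ H.edges, e ∉ P → H.snd e = M.snd e
  links_fst : ∀ e ∈ P, M.Links e z (H.fst e)
  links_snd : ∀ e ∈ P, M.Links (f e) z (H.snd e)
  notMem : ∀ e ∈ P, f e ∉ H.edges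
  injOn : ∀ e ∈ P, ∀ e' ∈ P, f e = f e' → e = e'
  cases : ∀ e ∈ M.edges, e ∈ H.edges ∨ (∃ e' ∈ P, e = f e') ∨ (M.fst e = z ∧ M.snd e = z)
  cut_le : ∀ X ⊆ V, H.cut X ≤ M.cut X

theorem Links.mem_left {M : FinMultigraph α β} {V : Finset α} (hM : M.EndsIn V) {e : β} {u v : α}
    (h : M.Links e u v) : u ∈ V := by
  have := hM e h.1
  rcases h.2 with ⟨h1, h2⟩ | ⟨h1, h2⟩ <;> grind

theorem Links.mem_right {M : FinMultigraph α β} {V : Finset α} (hM : M.EndsIn V) {e : β} {u v : α}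
    (h : M.Links e u v) : v ∈ V :=
  h.symm.mem_left hM

/-- The splitting lemma is iterated until no edge joins z to V. The condition on four sets is
required only for 0 < N: with constant bound k = 1 it fails, but there nothing has to be split off.
-/
theorem exists_completeSplitting {V : Finset α} {z : α} (hz : z ∉ V) (k : ℕ) (R : Finset α → ℕ)
    (hRk : ∀ X, R X ≤ k) (hRc : ∀ X ⊆ V, R (V \ X) = R X) (N : ℕ)
    (hR4 : 0 < N → ∀ A B C D : Finset α, A ⊆ V → B ⊆ V → C ⊆ V → D ⊆ V →
      A.Nonempty → B.Nonempty → C.Nonempty → D.Nonempty →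
      Disjoint A B → Disjoint A C → Disjoint A D → Disjoint B C → Disjoint B D → Disjoint C D →
      3 * k + 1 < R A + R B + R C + R D) :
    ∀ M : FinMultigraph α β, M.EndsIn (insert z V) →
      (∀ X ⊆ V, X.Nonempty → X ≠ V → R X ≤ M.cut X) → M.cut {z} = 2 * N →
      ∃ H P f, IsCompleteSplitting M H V z P f ∧
        ∀ X ⊆ V, X.Nonempty → X ≠ V → R X ≤ H.cut X := by
  induction N with
  | zero =>
    intro M hM hcut h0
    have hzero : ∀ e ∈ M.edges, M.fst e = z ↔ M.snd e = z := by
      intro e he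
      have := (Finset.sum_eq_zero_iff.1 h0) e he
      simpa [cross] using this
    -- What remains at z are loops, which are dropped; they form the last alternative in `cases`.
    let H : FinMultigraph α β := ⟨M.edges.filter fun e => M.fst e ≠ z, M.fst, M.snd⟩
    have hH : ∀ X, z ∉ X → H.cut X = M.cut X := by
      intro X hX
      simp only [cut, H]
      refine Finset.sum_subset (Finset.filter_subset _ _) fun e he he' => ?_
      have h1 : M.fst e = z := by simpa [he] using he'
      simp [cross, h1, (hzero e he).1 h1]
    refine ⟨H, ∅, id, ⟨by simp, Finset.filter_subset _ _, ?_, by simpa using h0.symm, by simp [H],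
      by simp [H], by simp, by simp, by simp, by simp, ?_, fun X hX => (hH X ?_).le⟩, ?_⟩
    · intro e he
      simp only [H, Finset.mem_filter] at he
      have h1 := hM e he.1
      have h2 := hzero e he.1
      simp only [Finset.mem_insert] at h1
      simp only [H]
      grind
    · intro e he
      have := hzero e he
      by_cases h : M.fst e = z
      · exact Or.inr (Or.inr ⟨h, this.1 h⟩)
      · exact Or.inl (by simp [H, he, h])
    · exact fun h => hz (hX h)
    · intro X hX hXn hXne
      rw [hH X fun h => hz (hX h)]
      exact hcut X hX hXn hXne
  | succ N ih =>
    intro M hM hcut hN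
    have hpos : ∃ e ∈ M.edges, cross (M.fst e) (M.snd e) {z} ≠ 0 := by
      by_contra! h
      have : M.cut {z} = 0 := Finset.sum_eq_zero h
      omega
    obtain ⟨e, he, hc⟩ := hpos
    have : ∃ t, M.Links e z t ∧ t ∈ V := by
      have hends := hM e he
      simp only [cross, Finset.mem_singleton, Finset.mem_insert] at hc hends
      by_cases h1 : M.fst e = z
      · exact ⟨M.snd e, ⟨he, Or.inl ⟨h1, rfl⟩⟩, by grind⟩
      · exact ⟨M.fst e, ⟨he, Or.inr ⟨rfl, by grind⟩⟩, by grind⟩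
    obtain ⟨t, het, ht⟩ := this
    obtain ⟨f, u, hfe, hf, hu, hsp⟩ := M.exists_split hz hM k R hRk hRc (hR4 N.succ_pos) hcut
      ⟨N + 1, by omega⟩ het ht
    have htz : t ≠ z := by rintro rfl; exact hz ht
    have huz : u ≠ z := by rintro rfl; exact hz hu
    have hends : (M.split e f t u).EndsIn (insert z V) := by
      intro e' he'
      have h1 := hM e' (Finset.mem_of_mem_erase he')
      simp only [split, Function.update_apply]
      split_ifs <;> simp [*]
    have hcz : (M.split e f t u).cut {z} = 2 * N := by
      have := M.cut_split hfe.symm het hf {z}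
      simp only [cross, Finset.mem_singleton, htz, huz] at this
      simp at this
      omega
    obtain ⟨H, P, g, hS, hHR⟩ := ih (fun _ => hR4 N.succ_pos) _ hends hsp hcz
    have hesp : e ∈ (M.split e f t u).edges := Finset.mem_erase.2 ⟨hfe.symm, het.1⟩
    have hfsp : f ∉ (M.split e f t u).edges := by simp [split]
    -- The edge e now joins t and u, so it is not at z and is not touched by later splittings.
    have hnz : ∀ e' ∈ P, e' ≠ e := by
      rintro e' he' rfl
      have := (hS.links_fst e' he').2
      simp only [split, Function.update_self] at this
      grind
    have hgne : ∀ e' ∈ P, g e' ≠ e ∧ g e' ≠ f := by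
      intro e' he'
      refine ⟨fun h => ?_, fun h => hfsp (h ▸ (hS.links_snd e' he').1)⟩
      have := (hS.links_snd e' he').2
      rw [h] at this
      simp only [split, Function.update_self] at this
      grind
    have heH : e ∈ H.edges := by
      rcases hS.cases e hesp with h | ⟨e', h1, h2⟩ | h
      · exact h
      · exact absurd h2.symm (hgne e' h1).1
      · exact absurd h.1 (by simpa [split] using htz)
    have heP : e ∉ P := fun h => hnz e h rfl
    have hHe : H.fst e = t ∧ H.snd e = u := by
      rw [hS.fst_eq e heH heP, hS.snd_eq e heH heP]
      simp [split]
    have hlk : ∀ e' x y, e' ≠ e → (M.split e f t u).Links e' x y → M.Links e' x y := by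
      intro e' x y hne h
      refine ⟨Finset.mem_of_mem_erase h.1, ?_⟩
      have := h.2
      simpa [split, Function.update_of_ne hne] using this
    have hup : ∀ e' ∈ P, Function.update g e f e' = g e' := fun e' he' =>
      Function.update_of_ne (hnz e' he') _ _
    refine ⟨H, insert e P, Function.update g e f, ⟨?_, ?_, hS.endsIn, ?_, ?_, ?_, ?_, ?_, ?_, ?_,
      ?_, ?_⟩, hHR⟩
    · exact Finset.insert_subset heH hS.subset
    · exact hS.edges_subset.trans (Finset.erase_subset _ _)
    · rw [Finset.card_insert_of_notMem heP]
      have := hS.two_mul_card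
      omega
    · intro e' he' hn
      rw [Finset.mem_insert, not_or] at hn
      rw [hS.fst_eq e' he' hn.2]
      simp [split, Function.update_of_ne hn.1]
    · intro e' he' hn
      rw [Finset.mem_insert, not_or] at hn
      rw [hS.snd_eq e' he' hn.2]
      simp [split, Function.update_of_ne hn.1]
    · intro e' he'
      rcases Finset.mem_insert.1 he' with rfl | he'
      · rwa [hHe.1]
      · exact hlk e' _ _ (hnz e' he') (hS.links_fst e' he')
    · intro e' he'
      rcases Finset.mem_insert.1 he' with rfl | he'
      · rwa [hHe.2, Function.update_self]
      · rw [hup e' he']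
        exact hlk _ _ _ (hgne e' he').1 (hS.links_snd e' he')
    · intro e' he'
      rcases Finset.mem_insert.1 he' with rfl | he'
      · rw [Function.update_self]
        exact fun h => hfsp (hS.edges_subset h)
      · rw [hup e' he']
        exact hS.notMem e' he'
    · intro e1 h1 e2 h2 h12
      rcases Finset.mem_insert.1 h1 with h1' | h1' <;>
        rcases Finset.mem_insert.1 h2 with h2' | h2'
      · rw [h1', h2']
      · rw [h1', Function.update_self, hup e2 h2'] at h12
        exact absurd h12.symm (hgne e2 h2').2
      · rw [h2', Function.update_self, hup e1 h1'] at h12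
        exact absurd h12 (hgne e1 h1').2
      · rw [hup e1 h1', hup e2 h2'] at h12
        exact hS.injOn e1 h1' e2 h2' h12
    · intro e' he'
      by_cases hef : e' = f
      · exact Or.inr (Or.inl ⟨e, Finset.mem_insert_self _ _, by simp [hef]⟩)
      by_cases hee : e' = e
      · exact Or.inl (hee ▸ heH)
      rcases hS.cases e' (Finset.mem_erase.2 ⟨hef, he'⟩) with h | ⟨e'', h1, h2⟩ | h
      · exact Or.inl h
      · exact Or.inr (Or.inl ⟨e'', Finset.mem_insert_of_mem h1, by rw [hup e'' h1, h2]⟩)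
      · refine Or.inr (Or.inr ?_)
        simpa [split, Function.update_of_ne hee] using h
    · intro X hX
      have h1 := M.cut_le_cut_split hfe.symm het hf X fun h => hz (hX h)
      have h2 := hS.cut_le X hX
      omega

/-! ### Forest systems and pinching -/

variable {m : ℕ}

/-- A system of arc-disjoint forests of `M`, indexed by `Option (Bool × Fin m)`, with the vertex set
`V`.  If `q i v = some (e, y)`, then the only arc of the forest `i` that leaves `v` runs along `e` to
`y`; no arc leaves `v` if `q i v = none`.  Along arcs the rank `r i` decreases.
The forests `some (c, j)` with the same `c` share no edge: they use the edge `e` only from its end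
`D c e` to its other end. -/
structure IsForestSystem (M : FinMultigraph α β) (V : Finset α) (d : α) (D : Bool → β → α)
    (q : Option (Bool × Fin m) → α → Option (β × α)) (r : Option (Bool × Fin m) → α → ℕ) :
    Prop where
  mem : ∀ {i v e y}, q i v = some (e, y) → v ∈ V
  ne_root : ∀ {i v e y}, q i v = some (e, y) → v ≠ d
  head_mem : ∀ {i v e y}, q i v = some (e, y) → y ∈ V
  links : ∀ {i v e y}, q i v = some (e, y) → M.Links e v y
  rank_lt : ∀ {i v e y}, q i v = some (e, y) → r i y < r i v
  orient : ∀ {c j v e y}, q (some (c, j)) v = some (e, y) → D c e = v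
  disj : ∀ {i i' v e y y'}, q i v = some (e, y) → q i' v = some (e, y') → i = i'
  ends : ∀ {e x y}, M.Links e x y → M.Links e (D true e) (D false e)

theorem exists_minimal_image {A : Type*} (p : A → Prop) (f : A → ℕ) (h : ∃ a, p a) :
    ∃ a, p a ∧ ∀ b, p b → f a ≤ f b := by
  classical
  have h' : ∃ n, ∃ a, p a ∧ f a = n := by
    obtain ⟨a, ha⟩ := h
    exact ⟨f a, a, ha, rfl⟩
  obtain ⟨a, ha, hn⟩ := Nat.find_spec h'
  exact ⟨a, ha, fun b hb => hn ▸ Nat.find_min' h' ⟨b, hb, rfl⟩⟩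

namespace IsForestSystem

variable {M H : FinMultigraph α β} {V : Finset α} {d : α} {D : Bool → β → α}
  {q : Option (Bool × Fin m) → α → Option (β × α)} {r : Option (Bool × Fin m) → α → ℕ}

theorem exists_dir (S : IsForestSystem M V d D q r) {e : β} {x y : α} (h : M.Links e x y) :
    ∃ c, D c e = x ∧ D (!c) e = y := by
  rcases h.eq_or_eq (S.ends h) with h | h
  · exact ⟨true, h.1.symm, h.2.symm⟩
  · exact ⟨false, h.1.symm, h.2.symm⟩

theorem ne (S : IsForestSystem M V d D q r) {i v e y} (h : q i v = some (e, y)) : v ≠ y := by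
  rintro rfl
  exact lt_irrefl _ (S.rank_lt h)

theorem orient_head (S : IsForestSystem M V d D q r) {c j v e y}
    (h : q (some (c, j)) v = some (e, y)) : D (!c) e = y := by
  obtain ⟨c', h1, h2⟩ := S.exists_dir (S.links h)
  have h3 := S.orient h
  have h4 := S.ne h
  cases c <;> cases c' <;> simp_all

/-- The choice of the arcs that leave a vertex `z` pinched to the edges of `P`: all forests but one
get an arc. A forest which uses edges of `P` gets the first of the arcs it enters. -/
theorem exists_choice (S : IsForestSystem H V d D q r) (P : Finset β) (hP : P.card = m)
    (F : Bool → β → β)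
    (hinj : ∀ e ∈ P, ∀ e' ∈ P, ∀ c c', F c e = F c' e' → c = c' ∧ e = e') :
    ∃ (ch : Option (Bool × Fin m) → Option (β × α)) (i₀ : Option (Bool × Fin m)),
      (∀ i, ch i = none ↔ i = i₀) ∧
      (∀ i l y, ch i = some (l, y) → ∃ c, ∃ e ∈ P, l = F c e ∧ y = D (!c) e ∧
        ∀ c' j, i = some (c', j) → c' = c) ∧
      (∀ i i' l y y', ch i = some (l, y) → ch i' = some (l, y') → i = i') ∧
      (∀ i l y, ch i = some (l, y) → ∀ v e y₁, q i v = some (e, y₁) → e ∈ P → r i y < r i v) ∧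
      (∀ v e y, q i₀ v = some (e, y) → e ∉ P) ∧
      (∀ c j, i₀ = some (c, j) → (∃ v, q none v ≠ none) ∧ ∃ e ∈ P, ∃ y, ch none = some (F c e, y)) ∧
      (∀ i l y, ch i = some (l, y) → (∃ v e, q i v = some (e, y)) ∨
        (i ≠ none ∧ ∀ v e y, q i v = some (e, y) → e ∉ P)) := by
  classical
  let vis : Option (Bool × Fin m) → α × β × α → Prop := fun i x =>
    q i x.1 = some x.2 ∧ x.2.1 ∈ P
  have hmin : ∀ i, (∃ x, vis i x) → ∃ x, vis i x ∧ ∀ b, vis i b → r i x.2.2 ≤ r i b.2.2 :=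
    fun i h => exists_minimal_image _ (fun x => r i x.2.2) h
  -- Each forest of kind c that uses P is sent to its edge in P with head of lowest rank. All
  -- forests of kind c use an edge from the same end, so by arc-disjointness this is injective; it
  -- extends to a bijection because P has m elements.
  have hkind : ∀ c, ∃ g : Fin m ≃ P, ∀ j, (∃ x, vis (some (c, j)) x) →
      ∃ x, vis (some (c, j)) x ∧ (∀ b, vis (some (c, j)) b →
        r (some (c, j)) x.2.2 ≤ r (some (c, j)) b.2.2) ∧ (g j : β) = x.2.1 := by
    intro c
    by_cases hα : Nonempty (α × β × α)
    · let φ : Fin m → α × β × α := fun j =>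
        if h : ∃ x, vis (some (c, j)) x then (hmin _ h).choose else hα.some
      have hφ : ∀ j, (∃ x, vis (some (c, j)) x) → vis (some (c, j)) (φ j) ∧
          ∀ b, vis (some (c, j)) b → r (some (c, j)) (φ j).2.2 ≤ r (some (c, j)) b.2.2 := by
        intro j h
        simp only [φ, dif_pos h]
        exact (hmin _ h).choose_spec
      obtain ⟨g, hg⟩ := Finset.exists_equiv_extend_of_card_eq (t := P)
        (s := Finset.univ.filter fun j => ∃ x, vis (some (c, j)) x) (f := fun j => (φ j).2.1)
        (by simp [hP]) (by
          intro e he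
          obtain ⟨j, hj, rfl⟩ := Finset.mem_image.1 he
          exact (hφ j (Finset.mem_filter.1 hj).2).1.2) (by
          intro j hj j' hj' hjj
          have h1 := (hφ j (Finset.mem_filter.1 hj).2).1.1
          have h2 := (hφ j' (Finset.mem_filter.1 hj').2).1.1
          have h3 := S.orient h1
          have h4 := S.orient h2
          simp only at hjj
          have h5 : (φ j).1 = (φ j').1 := by rw [← h3, ← h4, hjj]
          rw [h5] at h1
          have := S.disj (e := (φ j).2.1) (y := (φ j).2.2) (y' := (φ j').2.2) h1 (by rw [hjj]; exact h2)
          simpa using this)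
      exact ⟨g, fun j hj => ⟨φ j, (hφ j hj).1, (hφ j hj).2, hg j (by simp; exact ⟨_, _, _, (hφ j hj).1⟩)⟩⟩
    · refine ⟨(Fintype.equivFinOfCardEq (by simp [hP])).symm, fun j ⟨x, _⟩ => absurd ⟨x⟩ hα⟩
  choose g hg using hkind
  have hvisk : ∀ c j x, vis (some (c, j)) x → D c x.2.1 = x.1 ∧ D (!c) x.2.1 = x.2.2 :=
    fun c j x hx => ⟨S.orient hx.1, S.orient_head hx.1⟩
  have hrank : ∀ i x, vis i x → (∀ b, vis i b → r i x.2.2 ≤ r i b.2.2) →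
      ∀ v e y₁, q i v = some (e, y₁) → e ∈ P → r i x.2.2 < r i v := fun i x hx hm v e y₁ h he =>
    (hm (v, e, y₁) ⟨h, he⟩).trans_lt (S.rank_lt h)
  have hsomerank : ∀ c j, ∀ v e y₁, q (some (c, j)) v = some (e, y₁) → e ∈ P →
      r (some (c, j)) (D (!c) (g c j)) < r (some (c, j)) v := by
    intro c j v e y₁ h he
    obtain ⟨x, hx, hxm, hgx⟩ := hg c j ⟨(v, e, y₁), h, he⟩
    rw [hgx, (hvisk c j x hx).2]
    exact hrank _ x hx hxm v e y₁ h he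
  have hsomelast : ∀ c j, (∃ v e, q (some (c, j)) v = some (e, D (!c) (g c j))) ∨
      (some (c, j) ≠ none ∧ ∀ v e y, q (some (c, j)) v = some (e, y) → e ∉ P) := by
    intro c j
    by_cases h : ∃ x, vis (some (c, j)) x
    · obtain ⟨x, hx, -, hgx⟩ := hg c j h
      refine Or.inl ⟨x.1, x.2.1, ?_⟩
      rw [hgx, (hvisk c j x hx).2]
      exact hx.1
    · exact Or.inr ⟨by simp, fun v e y hv he => h ⟨(v, e, y), hv, he⟩⟩
  -- If `none` uses an edge of P, let e₀ be the one with head of lowest rank, used in the direction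
  -- of kind c₀. Then `none` takes the half of e₀ intended for a forest of kind c₀, which becomes
  -- i₀. Otherwise i₀ is `none` itself.
  by_cases hC : ∃ x, vis none x
  · obtain ⟨⟨v₀, e₀, y₀⟩, hx, hxm⟩ := hmin none hC
    obtain ⟨c₀, h1, h2⟩ := S.exists_dir (S.links hx.1)
    have he₀ : e₀ ∈ P := hx.2
    have hx1 : q none v₀ = some (e₀, y₀) := hx.1
    simp only at h1 h2
    have hj₀ : ∀ j, (g c₀ j : β) = e₀ ↔ j = (g c₀).symm ⟨e₀, he₀⟩ := by
      intro j
      rw [Equiv.eq_symm_apply, Subtype.ext_iff]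
    refine ⟨fun i => match i with
      | none => some (F c₀ e₀, y₀)
      | some (c, j) => if c = c₀ ∧ (g c j : β) = e₀ then none else some (F c (g c j), D (!c) (g c j)),
      some (c₀, (g c₀).symm ⟨e₀, he₀⟩), ?_, ?_, ?_, ?_, ?_, ?_, ?_⟩
    · rintro (_ | ⟨c, j⟩)
      · simp
      · simp only [ite_eq_left_iff, reduceCtorEq, imp_false, not_not, Option.some.injEq,
          Prod.mk.injEq]
        constructor
        · rintro ⟨rfl, h⟩
          exact ⟨rfl, (hj₀ j).1 h⟩
        · rintro ⟨rfl, h⟩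
          exact ⟨rfl, (hj₀ j).2 h⟩
    · rintro (_ | ⟨c, j⟩) l y h
      · simp only [Option.some.injEq, Prod.mk.injEq] at h
        exact ⟨c₀, e₀, he₀, h.1.symm, by rw [h2, h.2], by simp⟩
      · simp only at h
        split_ifs at h
        simp only [Option.some.injEq, Prod.mk.injEq] at h
        exact ⟨c, _, (g c j).2, h.1.symm, h.2.symm, by simp⟩
    · rintro (_ | ⟨c, j⟩) (_ | ⟨c', j'⟩) l y y' h h'
      · rfl
      · simp only at h h'
        split_ifs at h' with hn
        simp only [Option.some.injEq, Prod.mk.injEq] at h h'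
        have := hinj _ (g c' j').2 _ he₀ _ _ (h'.1.trans h.1.symm)
        exact absurd this hn
      · simp only at h h'
        split_ifs at h with hn
        simp only [Option.some.injEq, Prod.mk.injEq] at h h'
        have := hinj _ (g c j).2 _ he₀ _ _ (h.1.trans h'.1.symm)
        exact absurd this hn
      · simp only at h h'
        split_ifs at h h'
        simp only [Option.some.injEq, Prod.mk.injEq] at h h'
        obtain ⟨rfl, h3⟩ := hinj _ (g c j).2 _ (g c' j').2 _ _ (h.1.trans h'.1.symm)
        have := (g c).injective (Subtype.ext h3)
        rw [this]
    · rintro (_ | ⟨c, j⟩) l y h v e y₁ hv he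
      · simp only [Option.some.injEq, Prod.mk.injEq] at h
        rw [← h.2]
        exact hrank none _ hx hxm v e y₁ hv he
      · simp only at h
        split_ifs at h
        simp only [Option.some.injEq, Prod.mk.injEq] at h
        rw [← h.2]
        exact hsomerank c j v e y₁ hv he
    -- If i₀ used an edge of P, then the edge assigned to it, namely e₀, would be one it uses. It
    -- would use e₀ from the same end as `none`, against arc-disjointness.
    · intro v e y hv he
      obtain ⟨x, hx', -, hgx⟩ := hg _ _ ⟨(v, e, y), hv, he⟩
      rw [Equiv.apply_symm_apply] at hgx
      have h3 := (hvisk _ _ x hx').1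
      rw [← hgx] at h3
      simp only [h1] at h3
      have h4 : q _ x.1 = some (x.2.1, x.2.2) := hx'.1
      rw [← h3, ← hgx] at h4
      exact absurd (S.disj hx1 h4) (by simp)
    · intro c j h
      simp only [Option.some.injEq, Prod.mk.injEq] at h
      exact ⟨⟨v₀, by simp [hx1]⟩, e₀, he₀, y₀, by rw [h.1]⟩
    · rintro (_ | ⟨c, j⟩) l y h
      · simp only [Option.some.injEq, Prod.mk.injEq] at h
        exact Or.inl ⟨v₀, e₀, by rw [← h.2]; exact hx1⟩
      · simp only at h
        split_ifs at h
        simp only [Option.some.injEq, Prod.mk.injEq] at h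
        rw [← h.2]
        exact hsomelast c j
  · refine ⟨fun i => match i with
      | none => none
      | some (c, j) => some (F c (g c j), D (!c) (g c j)), none, ?_, ?_, ?_, ?_, ?_, by simp, ?_⟩
    · rintro (_ | ⟨c, j⟩) <;> simp
    · rintro (_ | ⟨c, j⟩) l y h
      · simp at h
      · simp only [Option.some.injEq, Prod.mk.injEq] at h
        exact ⟨c, _, (g c j).2, h.1.symm, h.2.symm, by simp⟩
    · rintro (_ | ⟨c, j⟩) (_ | ⟨c', j'⟩) l y y' h h'
      · rfl
      · simp at h
      · simp at h'
      · simp only [Option.some.injEq, Prod.mk.injEq] at h h'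
        obtain ⟨rfl, h3⟩ := hinj _ (g c j).2 _ (g c' j').2 _ _ (h.1.trans h'.1.symm)
        have := (g c).injective (Subtype.ext h3)
        rw [this]
    · rintro (_ | ⟨c, j⟩) l y h v e y₁ hv he
      · simp at h
      · simp only [Option.some.injEq, Prod.mk.injEq] at h
        rw [← h.2]
        exact hsomerank c j v e y₁ hv he
    · exact fun v e y hv he => hC ⟨(v, e, y), hv, he⟩
    · rintro (_ | ⟨c, j⟩) l y h
      · simp at h
      · simp only [Option.some.injEq, Prod.mk.injEq] at h
        rw [← h.2]
        exact hsomelast c j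

/-- Pinching the edges of `P` with a new vertex `z`. The edge `e ∈ P` becomes two edges, with the
labels `F c e`, where `F c e` joins `z` to `D (!c) e`. -/
theorem exists_pinch_aux (S : IsForestSystem H V d D q r) {z : α} (hz : z ∉ V) (hzd : z ≠ d)
    (hHV : H.EndsIn V) (P : Finset β) (hPH : P ⊆ H.edges) (hP : P.card = m) (F : Bool → β → β)
    (hinj : ∀ e ∈ P, ∀ e' ∈ P, ∀ c c', F c e = F c' e' → c = c' ∧ e = e')
    (hF : ∀ e ∈ P, ∀ c, M.Links (F c e) z (D (!c) e))
    (hFH : ∀ e ∈ P, ∀ c, F c e ∈ H.edges → F c e ∈ P)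
    (hkeep : ∀ e x y, H.Links e x y → e ∉ P → M.Links e x y)
    (hcases : ∀ e ∈ M.edges, (∃ c, ∃ e' ∈ P, e = F c e') ∨ (e ∈ H.edges ∧ e ∉ P) ∨
      (e ∉ H.edges ∧ M.Links e z z)) :
    ∃ D' q' r' i₀, IsForestSystem (m := m) M (insert z V) d D' q' r' ∧
      (∀ i v, v ≠ z → (q' i v = none ↔ q i v = none)) ∧
      (∀ i, q' i z = none ↔ i = i₀) ∧
      (∀ i v e y, v ≠ z → q i v = some (e, y) → ∃ e' y', q' i v = some (e', y') ∧
        (y' = y ∨ y' = z) ∧ ∀ c, D c e = v → D' c e' = v) ∧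
      (∀ v e, q' i₀ v ≠ some (e, z)) ∧
      (∀ c j, i₀ = some (c, j) → (∃ v, q none v ≠ none) ∧
        ∃ e y, q' none z = some (e, y) ∧ D' c e = z) ∧
      (∀ i e w, q' i z = some (e, w) → (∃ v e', q i v = some (e', w)) ∨
        (i ≠ none ∧ ∀ v e, q' i v ≠ some (e, z))) := by
  classical
  obtain ⟨ch, i₀, ha, hb, hc, hd, hd', he, hf⟩ := S.exists_choice P hP F hinj
  -- Kind c traverses e from D c e to D (!c) e, so it enters z through the half F (!c) e and leaves
  -- through F c e. The last clause concerns, among the edges of M, only loops at z.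
  obtain ⟨D', hD'F, hD'H, hD'z⟩ : ∃ D' : Bool → β → α,
      (∀ c b, ∀ e ∈ P, D' c (F b e) = if b = c then z else D c e) ∧
      (∀ c, ∀ l ∈ H.edges, l ∉ P → D' c l = D c l) ∧
      (∀ c l, l ∉ H.edges → (¬ ∃ b, ∃ e ∈ P, l = F b e) → D' c l = z) := by
    refine ⟨fun c l => if h : ∃ b, ∃ e ∈ P, l = F b e then
      (if h.choose = c then z else D c h.choose_spec.choose) else
      (if l ∈ H.edges then D c l else z), ?_, ?_, ?_⟩
    · intro c b e heP
      have h : ∃ b', ∃ e' ∈ P, F b e = F b' e' := ⟨b, e, heP, rfl⟩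
      have h2 := h.choose_spec.choose_spec
      obtain ⟨h3, h4⟩ := hinj _ heP _ h2.1 _ _ h2.2
      beta_reduce
      rw [dif_pos h, ← h4, ← h3]
    · intro c l hl hlP
      have h : ¬ ∃ b, ∃ e ∈ P, l = F b e := by
        rintro ⟨b, e, he, rfl⟩
        exact hlP (hFH e he b hl)
      beta_reduce
      rw [dif_neg h, if_pos hl]
    · intro c l hl h
      beta_reduce
      rw [dif_neg h, if_neg hl]
  -- An arc leaving v along a pinched edge now ends at z, using the half at v. Its Boolean is
  -- opposite to the direction in which the edge was traversed.
  let q' : Option (Bool × Fin m) → α → Option (β × α) := fun i v =>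
    if v = z then ch i else (q i v).map fun x =>
      if x.1 ∈ P then (F (if D true x.1 = v then false else true) x.1, z) else x
  -- Doubling makes room for z just above the head of its outgoing arc and still below every vertex
  -- that now leads to z. The value 0 is harmless, since i₀ neither enters nor leaves z.
  let r' : Option (Bool × Fin m) → α → ℕ := fun i v =>
    if v = z then (match ch i with | some x => 2 * r i x.2 + 1 | none => 0) else 2 * r i v
  have hq'z : ∀ i, q' i z = ch i := fun i => if_pos rfl
  have hzr : ∀ i l y, ch i = some (l, y) → r' i z = 2 * r i y + 1 := by
    intro i l y h
    simp only [r', if_true, h]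
  have hr' : ∀ i v, v ≠ z → r' i v = 2 * r i v := fun i v h => if_neg h
  have hq : ∀ i v e y, v ≠ z → q i v = some (e, y) →
      (e ∉ P ∧ q' i v = some (e, y)) ∨
      ∃ c, e ∈ P ∧ D c e = v ∧ D (!c) e = y ∧ q' i v = some (F (!c) e, z) := by
    intro i v e y hvz h
    by_cases heP : e ∈ P
    · right
      have hvy := S.ne h
      obtain ⟨c, h1, h2⟩ := S.exists_dir (S.links h)
      refine ⟨c, heP, h1, h2, ?_⟩
      simp only [q', if_neg hvz, h, Option.map_some, heP, if_true]
      cases c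
      · have : D true e ≠ v := by rw [show D true e = y from h2]; exact hvy.symm
        simp [this]
      · simp [h1]
    · left
      simp [q', hvz, h, heP]
  have hqnone : ∀ i v, v ≠ z → (q' i v = none ↔ q i v = none) := by
    intro i v hvz
    simp [q', hvz]
  have hq' : ∀ i v l y', v ≠ z → q' i v = some (l, y') → ∃ e y, q i v = some (e, y) ∧
      ((e ∉ P ∧ l = e ∧ y' = y) ∨
        ∃ c, e ∈ P ∧ D c e = v ∧ D (!c) e = y ∧ l = F (!c) e ∧ y' = z) := by
    intro i v l y' hvz h
    have h0 : q i v ≠ none := fun h0 => by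
      rw [(hqnone i v hvz).2 h0] at h
      cases h
    obtain ⟨⟨e, y⟩, hey⟩ := Option.ne_none_iff_exists'.1 h0
    refine ⟨e, y, hey, ?_⟩
    rcases hq i v e y hvz hey with ⟨h1, h2⟩ | ⟨c, h1, h2, h3, h4⟩
    · rw [h2] at h
      simp only [Option.some.injEq, Prod.mk.injEq] at h
      exact Or.inl ⟨h1, h.1.symm, h.2.symm⟩
    · rw [h4] at h
      simp only [Option.some.injEq, Prod.mk.injEq] at h
      exact Or.inr ⟨c, h1, h2, h3, h.1.symm, h.2.symm⟩
  have hDV : ∀ c, ∀ e ∈ P, D c e ∈ V := by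
    intro c e heP
    have hl : H.Links e (H.fst e) (H.snd e) := ⟨hPH heP, Or.inl ⟨rfl, rfl⟩⟩
    have := S.ends hl
    cases c
    · exact this.mem_right hHV
    · exact this.mem_left hHV
  have hori : ∀ i v e y l y', v ≠ z → q i v = some (e, y) → q' i v = some (l, y') →
      ∀ c, D c e = v → D' c l = v := by
    intro i v e y l y' hvz h h' c hcv
    rcases hq i v e y hvz h with ⟨h1, h2⟩ | ⟨c', h1, h2, h3, h4⟩
    · rw [h'] at h2
      simp only [Option.some.injEq, Prod.mk.injEq] at h2
      rw [h2.1, hD'H c e (S.links h).1 h1, hcv]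
    · rw [h'] at h4
      simp only [Option.some.injEq, Prod.mk.injEq] at h4
      have hne : (!c') ≠ c := by
        rintro rfl
        exact S.ne h (hcv.symm.trans h3)
      rw [h4.1, hD'F _ _ _ h1, if_neg hne, hcv]
  have hch : ∀ i l y, ch i = some (l, y) → y ∈ V ∧ M.Links l z y := by
    intro i l y h
    obtain ⟨c, e, heP, rfl, rfl, -⟩ := hb i l y h
    exact ⟨hDV _ _ heP, hF e heP c⟩
  have hVz : ∀ v ∈ V, v ≠ z := by
    rintro v hv rfl
    exact hz hv
  have hnovis : ∀ i, (∀ v e y, q i v = some (e, y) → e ∉ P) → ∀ v e, q' i v ≠ some (e, z) := by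
    intro i h v e hv
    by_cases hvz : v = z
    · subst hvz
      rw [hq'z] at hv
      exact hz (hch i _ _ hv).1
    · obtain ⟨e', y, h1, ⟨-, -, h2⟩ | ⟨c, h2, -⟩⟩ := hq' i v e z hvz hv
      · exact hz (h2 ▸ S.head_mem h1)
      · exact h v e' y h1 h2
  refine ⟨D', q', r', i₀, ⟨?_, ?_, ?_, ?_, ?_, ?_, ?_, ?_⟩, hqnone, fun i => by rw [hq'z, ha], ?_,
    hnovis i₀ hd', ?_, ?_⟩
  · intro i v l y h
    by_cases hvz : v = z
    · exact hvz ▸ Finset.mem_insert_self _ _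
    · obtain ⟨e', y', h1, -⟩ := hq' i v l y hvz h
      exact Finset.mem_insert_of_mem (S.mem h1)
  · intro i v l y h
    by_cases hvz : v = z
    · exact hvz ▸ hzd
    · obtain ⟨e', y', h1, -⟩ := hq' i v l y hvz h
      exact S.ne_root h1
  · intro i v l y h
    by_cases hvz : v = z
    · subst hvz
      rw [hq'z] at h
      exact Finset.mem_insert_of_mem (hch i _ _ h).1
    · obtain ⟨e', y', h1, ⟨-, -, rfl⟩ | ⟨c, -, -, -, -, rfl⟩⟩ := hq' i v l y hvz h
      · exact Finset.mem_insert_of_mem (S.head_mem h1)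
      · exact Finset.mem_insert_self _ _
  · intro i v l y h
    by_cases hvz : v = z
    · subst hvz
      rw [hq'z] at h
      exact (hch i _ _ h).2
    · obtain ⟨e', y', h1, ⟨h2, rfl, rfl⟩ | ⟨c, h2, h3, -, rfl, rfl⟩⟩ := hq' i v l y hvz h
      · exact hkeep _ _ _ (S.links h1) h2
      · have := hF e' h2 (!c)
        rw [Bool.not_not, h3] at this
        exact this.symm
  · intro i v l y h
    by_cases hvz : v = z
    · subst hvz
      rw [hq'z] at h
      rw [hzr i l y h, hr' i y (hVz y (hch i _ _ h).1)]
      omega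
    · rw [hr' i v hvz]
      obtain ⟨e', y', h1, ⟨h2, rfl, rfl⟩ | ⟨c, h2, h3, -, rfl, rfl⟩⟩ := hq' i v l y hvz h
      · rw [hr' i _ (hVz _ (S.head_mem h1))]
        have := S.rank_lt h1
        omega
      · have h4 : ch i ≠ none := by
          rw [Ne, ha]
          rintro rfl
          exact hd' v e' y' h1 h2
        obtain ⟨⟨l', y''⟩, h5⟩ := Option.ne_none_iff_exists'.1 h4
        rw [hzr i _ _ h5]
        have := hd i _ _ h5 v e' y' h1 h2
        omega
  · intro c j v l y h
    by_cases hvz : v = z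
    · subst hvz
      rw [hq'z] at h
      obtain ⟨c', e, heP, rfl, -, h2⟩ := hb _ _ _ h
      rw [hD'F _ _ _ heP, if_pos (h2 c j rfl).symm]
    · obtain ⟨e', y', h1, -⟩ := hq' _ v l y hvz h
      exact hori _ v e' y' l y hvz h1 h c (S.orient h1)
  · intro i i' v l y y' h h'
    by_cases hvz : v = z
    · subst hvz
      rw [hq'z] at h h'
      exact hc i i' l y y' h h'
    · obtain ⟨e1, y1, h1, h2⟩ := hq' i v l y hvz h
      obtain ⟨e2, y2, h1', h2'⟩ := hq' i' v l y' hvz h'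
      have : e1 = e2 := by
        rcases h2 with ⟨g1, g2, -⟩ | ⟨c, g1, -, -, g2, -⟩ <;>
          rcases h2' with ⟨g1', g2', -⟩ | ⟨c', g1', -, -, g2', -⟩
        · exact g2.symm.trans g2'
        · refine absurd ?_ g1
          have h3 := g2.symm.trans g2'
          rw [h3]
          exact hFH _ g1' _ (h3 ▸ (S.links h1).1)
        · refine absurd ?_ g1'
          have h3 := g2'.symm.trans g2
          rw [h3]
          exact hFH _ g1 _ (h3 ▸ (S.links h1').1)
        · exact (hinj _ g1 _ g1' _ _ (g2.symm.trans g2')).2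
      subst this
      exact S.disj h1 h1'
  · intro l x y h
    rcases hcases l h.1 with ⟨c, e, heP, rfl⟩ | ⟨h1, h2⟩ | ⟨h1, h2⟩
    · have := hF e heP c
      cases c
      · have := this.symm
        simpa [hD'F _ _ _ heP] using this
      · simpa [hD'F _ _ _ heP] using this
    · rw [hD'H _ _ h1 h2, hD'H _ _ h1 h2]
      exact hkeep _ _ _ (S.ends (x := H.fst l) (y := H.snd l) ⟨h1, Or.inl ⟨rfl, rfl⟩⟩) h2
    · by_cases h3 : ∃ b, ∃ e ∈ P, l = F b e
      · obtain ⟨b, e, heP, rfl⟩ := h3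
        rcases (hF e heP b).eq_or_eq h2 with h4 | h4 <;>
          exact absurd (hDV (!b) e heP) (h4.2 ▸ hz)
      · rwa [hD'z _ _ h1 h3, hD'z _ _ h1 h3]
  · intro i v e y hvz h
    rcases hq i v e y hvz h with ⟨h1, h2⟩ | ⟨c', h1, h2, h3, h4⟩
    · exact ⟨e, y, h2, Or.inl rfl, hori i v e y _ _ hvz h h2⟩
    · exact ⟨_, z, h4, Or.inr rfl, hori i v e y _ _ hvz h h4⟩
  · intro c j hi
    obtain ⟨h1, e, heP, y, h2⟩ := he c j hi
    exact ⟨h1, F c e, y, by rw [hq'z, h2], by rw [hD'F _ _ _ heP, if_pos rfl]⟩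
  · intro i e w h
    rw [hq'z] at h
    rcases hf i e w h with h | ⟨h1, h2⟩
    · exact Or.inl h
    · exact Or.inr ⟨h1, hnovis i h2⟩

/-- Forest systems are transferred back along a complete splitting. -/
theorem exists_pinch (S : IsForestSystem H V d D q r) {z : α} (hz : z ∉ V) (hzd : z ≠ d)
    {P : Finset β} {f : β → β} (hS : IsCompleteSplitting M H V z P f) (hcut : M.cut {z} = 2 * m) :
    ∃ D' q' r' i₀, IsForestSystem (m := m) M (insert z V) d D' q' r' ∧
      (∀ i v, v ≠ z → (q' i v = none ↔ q i v = none)) ∧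
      (∀ i, q' i z = none ↔ i = i₀) ∧
      (∀ i v e y, v ≠ z → q i v = some (e, y) → ∃ e' y', q' i v = some (e', y') ∧
        (y' = y ∨ y' = z) ∧ ∀ c, D c e = v → D' c e' = v) ∧
      (∀ v e, q' i₀ v ≠ some (e, z)) ∧
      (∀ c j, i₀ = some (c, j) → (∃ v, q none v ≠ none) ∧
        ∃ e y, q' none z = some (e, y) ∧ D' c e = z) ∧
      (∀ i e w, q' i z = some (e, w) → (∃ v e', q i v = some (e', w)) ∨
        (i ≠ none ∧ ∀ v e, q' i v ≠ some (e, z))) := by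
  have hlk : ∀ e ∈ H.edges, H.Links e (H.fst e) (H.snd e) := fun e he => ⟨he, Or.inl ⟨rfl, rfl⟩⟩
  -- The halves e and f e are attached to `H.fst e` and `H.snd e`; F c e selects the one attached to
  -- D (!c) e.
  let F : Bool → β → β := fun c e => if (D true e = H.fst e ↔ c = true) then f e else e
  have hFmem : ∀ c e, F c e = e ∨ F c e = f e := by
    intro c e
    simp only [F]
    split_ifs <;> simp
  refine S.exists_pinch_aux hz hzd hS.endsIn P hS.subset ?_ F ?_ ?_ ?_ ?_ ?_
  · have := hS.two_mul_card
    omega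
  · intro e he e' he' c c' h
    have hne1 : f e ≠ e' := fun h => hS.notMem e he (h ▸ hS.subset he')
    have hne2 : f e' ≠ e := fun h => hS.notMem e' he' (h ▸ hS.subset he)
    have hee : e = e' := by
      rcases hFmem c e with h1 | h1 <;> rcases hFmem c' e' with h2 | h2 <;> rw [h1, h2] at h
      · exact h
      · exact absurd h.symm hne2
      · exact absurd h hne1
      · exact hS.injOn e he e' he' h
    subst hee
    refine ⟨?_, rfl⟩
    by_contra hcc
    have : c' = !c := by cases c <;> cases c' <;> simp_all
    subst this
    simp only [F] at h
    cases c <;> by_cases h0 : D true e = H.fst e <;> simp [h0] at h <;>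
      first | exact hne1 h | exact hne1 h.symm
  · intro e he c
    have h1 := hS.links_fst e he
    have h2 := hS.links_snd e he
    have h3 := (hlk e (hS.subset he)).eq_or_eq (S.ends (hlk e (hS.subset he)))
    simp only [F]
    by_cases h0 : D true e = H.fst e
    · have h4 : D false e = H.snd e := by
        rcases h3 with h | h
        · exact h.2.symm
        · rw [← h.1, h.2, h0]
      cases c <;> simp [h0, h4, h1, h2]
    · have h4 : D false e = H.fst e ∧ D true e = H.snd e := by
        rcases h3 with h | h
        · exact absurd h.1.symm h0
        · exact ⟨h.1.symm, h.2.symm⟩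
      cases c <;> simp [h0, h4.1, h1]
      rw [h4.2]
      exact h2
  · intro e he c h
    rcases hFmem c e with h1 | h1
    · rwa [h1]
    · exact absurd (h1 ▸ h) (hS.notMem e he)
  · rintro e x y ⟨he, h⟩ hP
    refine ⟨hS.edges_subset he, ?_⟩
    rwa [← hS.fst_eq e he hP, ← hS.snd_eq e he hP]
  · intro e he
    have hboth : ∀ e ∈ P, ∀ l, (l = e ∨ l = f e) → ∃ c, ∃ e' ∈ P, l = F c e' := by
      intro e he l hl
      have : F true e = e ∧ F false e = f e ∨ F true e = f e ∧ F false e = e := by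
        simp only [F]
        by_cases h0 : D true e = H.fst e <;> simp [h0]
      rcases hl with rfl | rfl <;> rcases this with h | h
      · exact ⟨true, l, he, h.1.symm⟩
      · exact ⟨false, l, he, h.2.symm⟩
      · exact ⟨false, e, he, h.2.symm⟩
      · exact ⟨true, e, he, h.1.symm⟩
    by_cases heP : e ∈ P
    · exact Or.inl (hboth e heP e (Or.inl rfl))
    by_cases heH : e ∈ H.edges
    · exact Or.inr (Or.inl ⟨heH, heP⟩)
    rcases hS.cases e he with h | ⟨e', h1, h2⟩ | h
    · exact absurd h heH
    · exact Or.inl (hboth e' h1 e (Or.inr h2))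
    · exact Or.inr (Or.inr ⟨heH, he, Or.inl h⟩)

end IsForestSystem

/-! ### Changing single arcs of a forest system -/

/-- The multigraph `M` without the edge `g`. -/
def eraseEdge (M : FinMultigraph α β) (g : β) : FinMultigraph α β :=
  ⟨M.edges.erase g, M.fst, M.snd⟩

theorem Links.of_eraseEdge {M : FinMultigraph α β} {g e : β} {x y : α}
    (h : (M.eraseEdge g).Links e x y) : M.Links e x y :=
  ⟨Finset.mem_of_mem_erase h.1, h.2⟩

/-- The function `q` with its value at `i`, `v` replaced by `x`. -/
def upd {ι γ : Type*} [DecidableEq ι] (q : ι → α → γ) (i : ι) (v : α) (x : γ) : ι → α → γ :=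
  fun i' v' => if i' = i ∧ v' = v then x else q i' v'

theorem upd_self {ι γ : Type*} [DecidableEq ι] (q : ι → α → γ) (i : ι) (v : α) (x : γ) :
    upd q i v x i v = x := by
  simp [upd]

theorem upd_of_ne_left {ι γ : Type*} [DecidableEq ι] (q : ι → α → γ) {i i' : ι} (v v' : α) (x : γ)
    (h : i' ≠ i) : upd q i v x i' v' = q i' v' := by
  simp [upd, h]

theorem upd_of_ne_right {ι γ : Type*} [DecidableEq ι] (q : ι → α → γ) (i i' : ι) {v v' : α} (x : γ)
    (h : v' ≠ v) : upd q i v x i' v' = q i' v' := by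
  simp [upd, h]

theorem upd_eq_some {ι γ : Type*} [DecidableEq ι] {q : ι → α → Option γ} {i i' : ι} {v v' : α}
    {x : Option γ} {y : γ} (h : upd q i v x i' v' = some y) :
    (i' = i ∧ v' = v ∧ x = some y) ∨ (¬ (i' = i ∧ v' = v) ∧ q i' v' = some y) := by
  unfold upd at h
  split_ifs at h with h1
  · exact Or.inl ⟨h1.1, h1.2, h⟩
  · exact Or.inr ⟨h1, h⟩

namespace IsForestSystem

variable {M : FinMultigraph α β} {V : Finset α} {d : α} {D : Bool → β → α}
  {q : Option (Bool × Fin m) → α → Option (β × α)} {r : Option (Bool × Fin m) → α → ℕ}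

theorem unassign (S : IsForestSystem M V d D q r) (i : Option (Bool × Fin m)) (v : α) :
    IsForestSystem M V d D (upd q i v none) r := by
  have key : ∀ {i' v' x}, upd q i v none i' v' = some x → q i' v' = some x := by
    intro i' v' x h
    rcases upd_eq_some h with ⟨-, -, h⟩ | ⟨-, h⟩
    · cases h
    · exact h
  exact ⟨fun h => S.mem (key h), fun h => S.ne_root (key h), fun h => S.head_mem (key h),
    fun h => S.links (key h), fun h => S.rank_lt (key h), fun h => S.orient (key h),
    fun h h' => S.disj (key h) (key h'), S.ends⟩

/-- The arc `e` from `v` to `y` is given to the forest `i`, in place of the arc which it may have at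
`v`. -/
theorem assign (S : IsForestSystem M V d D q r) (i : Option (Bool × Fin m)) {v y : α} {e : β}
    (hv : v ∈ V) (hvd : v ≠ d) (hy : y ∈ V) (he : M.Links e v y) (hvy : v ≠ y)
    (hfree : ∀ i' y', i' ≠ i → q i' v ≠ some (e, y'))
    (hor : ∀ c j, i = some (c, j) → D c e = v)
    (hr : r i y ≤ r i v ∨ ∀ u e', q i u ≠ some (e', v)) :
    ∃ r', IsForestSystem M V d D (upd q i v (some (e, y))) r' := by
  have main : ∀ r' : Option (Bool × Fin m) → α → ℕ,
      (∀ {i' v' e' y'}, ¬ (i' = i ∧ v' = v) → q i' v' = some (e', y') → r' i' y' < r' i' v') →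
      r' i y < r' i v → IsForestSystem M V d D (upd q i v (some (e, y))) r' := by
    intro r' h1 h2
    refine ⟨?_, ?_, ?_, ?_, ?_, ?_, ?_, S.ends⟩
    · intro i' v' e' y' h
      rcases upd_eq_some h with ⟨rfl, rfl, hx⟩ | ⟨h0, h⟩
      · exact hv
      · exact S.mem h
    · intro i' v' e' y' h
      rcases upd_eq_some h with ⟨rfl, rfl, hx⟩ | ⟨h0, h⟩
      · exact hvd
      · exact S.ne_root h
    · intro i' v' e' y' h
      rcases upd_eq_some h with ⟨rfl, rfl, hx⟩ | ⟨h0, h⟩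
      · simp only [Option.some.injEq, Prod.mk.injEq] at hx
        exact hx.2 ▸ hy
      · exact S.head_mem h
    · intro i' v' e' y' h
      rcases upd_eq_some h with ⟨rfl, rfl, hx⟩ | ⟨h0, h⟩
      · simp only [Option.some.injEq, Prod.mk.injEq] at hx
        rw [← hx.1, ← hx.2]
        exact he
      · exact S.links h
    · intro i' v' e' y' h
      rcases upd_eq_some h with ⟨rfl, rfl, hx⟩ | ⟨h0, h⟩
      · simp only [Option.some.injEq, Prod.mk.injEq] at hx
        rwa [← hx.2]
      · exact h1 h0 h
    · intro c j v' e' y' h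
      rcases upd_eq_some h with ⟨h0, rfl, hx⟩ | ⟨h0, h⟩
      · simp only [Option.some.injEq, Prod.mk.injEq] at hx
        rw [← hx.1]
        exact hor c j h0.symm
      · exact S.orient h
    · intro i1 i2 v' e' y1 y2 h h'
      rcases upd_eq_some h with ⟨g1, g2, hx⟩ | ⟨h0, hx⟩ <;>
        rcases upd_eq_some h' with ⟨g1', g2', hx'⟩ | ⟨h0', hx'⟩
      · rw [g1, g1']
      · simp only [Option.some.injEq, Prod.mk.injEq] at hx
        subst g2
        rw [← hx.1] at hx'
        exact absurd hx' (hfree _ _ fun h => h0' ⟨h, rfl⟩)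
      · simp only [Option.some.injEq, Prod.mk.injEq] at hx'
        subst g2'
        rw [← hx'.1] at hx
        exact absurd hx (hfree _ _ fun h => h0 ⟨h, rfl⟩)
      · exact S.disj hx hx'
  -- If y has rank at most that of v, doubling the ranks and raising v by 1 makes the new arc
  -- descend. If nothing enters v, its rank can be chosen freely above that of y.
  rcases hr with hr | hr
  · refine ⟨fun i' u => if i' = i then 2 * r i u + (if u = v then 1 else 0) else r i' u,
      main _ ?_ ?_⟩
    · intro i' v' e' y' h0 h
      have := S.rank_lt h
      by_cases hi : i' = i
      · subst hi
        simp only [if_true]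
        split_ifs <;> omega
      · simpa [hi] using this
    · simp only [if_true, if_neg hvy.symm]
      omega
  · refine ⟨upd r i v (r i y + 1), main _ ?_ ?_⟩
    · intro i' v' e' y' h0 h
      have := S.rank_lt h
      have h1 : ¬ (i' = i ∧ y' = v) := by
        rintro ⟨rfl, rfl⟩
        exact hr _ _ h
      simpa [upd, h0, h1] using this
    · rw [upd_self, upd_of_ne_right _ _ _ _ hvy.symm]
      omega

theorem ne_erased {g : β} (S : IsForestSystem (M.eraseEdge g) V d D q r) {i v e y}
    (h : q i v = some (e, y)) : e ≠ g :=
  (Finset.mem_erase.1 (S.links h).1).1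

/-- No forest uses the restored edge, so its direction is still free to choose. -/
theorem addEdge {g : β} (S : IsForestSystem (M.eraseEdge g) V d D q r) {x y : α}
    (hg : M.Links g x y) (c : Bool) :
    ∃ D', IsForestSystem M V d D' q r ∧ D' c g = x ∧ D' (!c) g = y ∧
      ∀ b e, e ≠ g → D' b e = D b e := by
  refine ⟨fun b e => if e = g then (if b = c then x else y) else D b e,
    ⟨S.mem, S.ne_root, S.head_mem, fun h => (S.links h).of_eraseEdge, S.rank_lt, ?_, S.disj, ?_⟩,
    by simp, by simp, fun b e h => if_neg h⟩
  · intro c j v e y h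
    simp only [if_neg (S.ne_erased h)]
    exact S.orient h
  · intro e u v h
    by_cases he : e = g
    · subst he
      simp only [if_true]
      cases c
      · exact hg.symm
      · exact hg
    · simp only [if_neg he]
      exact (S.ends (x := u) (y := v) ⟨Finset.mem_erase.2 ⟨he, h.1⟩, h.2⟩).of_eraseEdge

/-! ### Supplying missing arcs -/

/-- A single missing arc at `z` is supplied along an additional edge `g` at `z`. -/
theorem exists_complete_of_one_missing {g : β} {z w : α} {i₀ : Option (Bool × Fin m)}
    (S : IsForestSystem (M.eraseEdge g) V d D q r) (hz : z ∈ V) (hzd : z ≠ d) (hw : w ∈ V)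
    (hg : M.Links g z w) (hzw : z ≠ w) (hin : ∀ v e, q i₀ v ≠ some (e, z))
    (hcomp : ∀ i, ∀ v ∈ V, v ≠ d → q i v = none → i = i₀ ∧ v = z) :
    ∃ D' q' r', IsForestSystem (m := m) M V d D' q' r' ∧
      ∀ i, ∀ v ∈ V, v ≠ d → q' i v ≠ none := by
  obtain ⟨D', S', hD, -, -⟩ := S.addEdge hg (match i₀ with | some (c, _) => c | none => true)
  obtain ⟨r', S''⟩ := S'.assign i₀ hz hzd hw hg hzw
    (fun i' y' _ h => S.ne_erased h rfl) (by rintro c j rfl; exact hD) (Or.inr hin)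
  refine ⟨D', _, r', S'', fun i v hv hvd h => ?_⟩
  unfold upd at h
  split_ifs at h with h1
  exact h1 (hcomp i v hv hvd h)

/-- The forest `i` has no arcs at `z` and `w`. The forest `a` exchanges its arc at `w` for one
to `z`, and `i` reaches this arc through `z` and `w`. -/
theorem exists_complete_of_exchange {z w : α} {i a : Option (Bool × Fin m)}
    (S : IsForestSystem M V d D q r) (hz : z ∈ V) (hzd : z ≠ d) (hw : w ∈ V) (hwd : w ≠ d)
    (hzw : z ≠ w) (hai : a ≠ i)
    (hcomp : ∀ i', ∀ v ∈ V, v ≠ d → q i' v = none → i' = i ∧ (v = z ∨ v = w))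
    (hinz : ∀ v e, q i v ≠ some (e, z)) (hinw : ∀ v e, q i v ≠ some (e, w))
    {l₁ l₂ : β} (hl₁ : M.Links l₁ z w) (hl₂ : M.Links l₂ z w)
    (hf₁ : ∀ i' y, q i' z ≠ some (l₁, y)) (hf₂ : ∀ i' y, q i' w ≠ some (l₂, y))
    {e : β} {y : α} (haw : q a w = some (e, y)) (hy : y ≠ z) (hr : r a z ≤ r a w)
    (hora : ∀ c j, a = some (c, j) → D c l₂ = w)
    (hori : ∀ c j, i = some (c, j) → D c l₁ = z ∧ D c e = w) :
    ∃ q' r', IsForestSystem (m := m) M V d D q' r' ∧ ∀ i, ∀ v ∈ V, v ≠ d → q' i v ≠ none := by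
  -- The order of assignments matters: `a` first turns to z along l₂, which frees e; then `i` takes
  -- e at w, and only then enters w from z. No cycle arises in `i`, because y ≠ z and nothing else
  -- of `i` enters z or w.
  have hel : l₂ ≠ e := by
    rintro rfl
    exact hf₂ _ _ haw
  obtain ⟨r₁, S₁⟩ := S.assign a hw hwd hz hl₂.symm hzw.symm (fun i' y' _ => hf₂ i' y') hora
    (Or.inl hr)
  obtain ⟨r₂, S₂⟩ := S₁.assign i (e := e) (y := y) hw hwd (S.head_mem haw) (S.links haw) (S.ne haw)
    (by
      intro i' y' hi' h
      rcases upd_eq_some h with ⟨h1, h2, h3⟩ | ⟨h1, h2⟩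
      · simp only [Option.some.injEq, Prod.mk.injEq] at h3
        exact hel h3.1
      · exact h1 ⟨S.disj h2 haw, rfl⟩)
    (fun c j h => (hori c j h).2)
    (by
      right
      intro u e' h
      rw [upd_of_ne_left _ _ _ _ hai.symm] at h
      exact hinw _ _ h)
  obtain ⟨r₃, S₃⟩ := S₂.assign i (e := l₁) hz hzd hw hl₁ hzw
    (by
      intro i' y' hi' h
      rw [upd_of_ne_left _ _ _ _ hi', upd_of_ne_right _ _ _ _ hzw] at h
      exact hf₁ _ _ h)
    (fun c j h => (hori c j h).1)
    (by
      right
      intro u e' h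
      rcases upd_eq_some h with ⟨-, h2, h3⟩ | ⟨h1, h2⟩
      · simp only [Option.some.injEq, Prod.mk.injEq] at h3
        exact hy h3.2
      · rw [upd_of_ne_left _ _ _ _ hai.symm] at h2
        exact hinz _ _ h2)
  refine ⟨_, r₃, S₃, fun i' v hv hvd h => ?_⟩
  unfold upd at h
  split_ifs at h with h1 h2 h3
  have := hcomp i' v hv hvd h
  tauto

/-- Pigeonhole: two forests of one kind cannot use the same edge, in either direction, so fewer than
|T| available edges between z and w leave some forest of T without any. -/
theorem exists_avoiding (S : IsForestSystem M V d D q r) {z w : α} (hzw : z ≠ w) (c : Bool)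
    (T : Finset (Fin m)) (B : Finset β) (hBT : B.card < T.card)
    (hB : ∀ k ∈ T, ∀ e, q (some (c, k)) z = some (e, w) ∨ q (some (c, k)) w = some (e, z) → e ∈ B) :
    ∃ k ∈ T, (∀ e, q (some (c, k)) z ≠ some (e, w)) ∧ ∀ e, q (some (c, k)) w ≠ some (e, z) := by
  by_contra! hcon
  have : ∀ k ∈ T, ∃ e, q (some (c, k)) z = some (e, w) ∨ q (some (c, k)) w = some (e, z) := by
    intro k hk
    by_cases h : ∃ e, q (some (c, k)) z = some (e, w)
    · obtain ⟨e, he⟩ := h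
      exact ⟨e, Or.inl he⟩
    · obtain ⟨e, he⟩ := hcon k hk fun e he => h ⟨e, he⟩
      exact ⟨e, Or.inr he⟩
  have : ∃ f : Fin m → Option β, ∀ k ∈ T, ∃ e, f k = some e ∧
      (q (some (c, k)) z = some (e, w) ∨ q (some (c, k)) w = some (e, z)) := by
    choose f hf using this
    exact ⟨fun k => if h : k ∈ T then some (f k h) else none, fun k hk => ⟨f k hk, by simp [hk], hf k hk⟩⟩
  obtain ⟨f, hf⟩ := this
  obtain ⟨k, hk, k', hk', hne, hkk⟩ := Finset.exists_ne_map_eq_of_card_lt_of_maps_to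
    (s := T) (t := B.map Function.Embedding.some) (by rwa [Finset.card_map]) (f := f) (by
      intro k hk
      obtain ⟨e, he, h⟩ := hf k hk
      rw [he]
      exact Finset.mem_map_of_mem _ (hB k hk e h))
  obtain ⟨e, he, h⟩ := hf k hk
  obtain ⟨e', he', h'⟩ := hf k' hk'
  have hee : e = e' := by simpa [he, he'] using hkk
  subst hee
  rcases h with h | h <;> rcases h' with h' | h'
  · exact hne (by simpa using S.disj h h')
  · exact hzw ((S.orient h).symm.trans (S.orient h'))
  · exact hzw ((S.orient h').symm.trans (S.orient h))
  · exact hne (by simpa using S.disj h h')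

open Classical in
/-- The edges of `M` between `z` and `w`. -/
noncomputable def _root_.FinMultigraph.parallel (M : FinMultigraph α β) (z w : α) : Finset β :=
  M.edges.filter fun e => M.Links e z w

theorem _root_.FinMultigraph.mem_parallel {M : FinMultigraph α β} {z w : α} {e : β} :
    e ∈ M.parallel z w ↔ M.Links e z w := by
  simp only [parallel, Finset.mem_filter, and_iff_right_iff_imp]
  exact fun h => h.1

theorem _root_.FinMultigraph.parallel_comm (M : FinMultigraph α β) (z w : α) :
    M.parallel z w = M.parallel w z := by
  ext e
  rw [mem_parallel, mem_parallel]
  exact ⟨Links.symm, Links.symm⟩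

/-- The forest `(c, k)` has no arcs at `z` and `w`, and there are free arcs from `z` to `w` and
from `w` to `z`, along different edges. -/
theorem exists_complete_of_free_pair {z w : α} {c : Bool} {k : Fin m}
    (S : IsForestSystem M V d D q r) (hz : z ∈ V) (hzd : z ≠ d) (hw : w ∈ V) (hwd : w ≠ d)
    (hzw : z ≠ w) (hpar : (M.parallel z w).card ≤ m)
    (hcomp : ∀ i', ∀ v ∈ V, v ≠ d → q i' v = none → i' = some (c, k) ∧ (v = z ∨ v = w))
    (hiz : q (some (c, k)) z = none) (hiw : q (some (c, k)) w = none)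
    (hinz : ∀ v e, q (some (c, k)) v ≠ some (e, z)) (hinw : ∀ v e, q (some (c, k)) v ≠ some (e, w))
    {h g : β} (hhg : h ≠ g) (hh : M.Links h z w) (hg : M.Links g z w)
    (hDh : D c h = z) (hDg : D c g = w)
    (hfh : ∀ i' y, q i' z ≠ some (h, y)) (hfg : ∀ i' y, q i' w ≠ some (g, y)) :
    ∃ q' r', IsForestSystem (m := m) M V d D q' r' ∧ ∀ i, ∀ v ∈ V, v ≠ d → q' i v ≠ none := by
  have hsub : ({h, g} : Finset β) ⊆ M.parallel z w := by
    intro e he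
    rw [Finset.mem_insert, Finset.mem_singleton] at he
    rcases he with rfl | rfl
    · exact mem_parallel.2 hh
    · exact mem_parallel.2 hg
  have h2 : 2 ≤ (M.parallel z w).card := by
    rw [← Finset.card_pair hhg]
    exact Finset.card_le_card hsub
  -- There are m - 1 other forests of kind c and at most m - 2 edges between z and w besides h and
  -- g. Kind c uses neither h nor g, as in the directions allowed to it both are free.
  obtain ⟨a, ha, ha1, ha2⟩ := S.exists_avoiding hzw c (Finset.univ.erase k)
    (M.parallel z w \ {h, g})
    (by
      rw [Finset.card_sdiff_of_subset hsub, Finset.card_pair hhg,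
        Finset.card_erase_of_mem (Finset.mem_univ _), Finset.card_univ, Fintype.card_fin]
      omega)
    (by
      intro a ha e he
      rw [Finset.mem_sdiff, mem_parallel, Finset.mem_insert, Finset.mem_singleton, not_or]
      rcases he with he | he
      · refine ⟨S.links he, ?_, ?_⟩
        · rintro rfl
          exact hfh _ _ he
        · rintro rfl
          exact hzw ((S.orient he).symm.trans hDg)
      · refine ⟨(S.links he).symm, ?_, ?_⟩
        · rintro rfl
          exact hzw (hDh.symm.trans (S.orient he))
        · rintro rfl
          exact hfg _ _ he)
  have hak : some (c, a) ≠ some (c, k) := by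
    simpa using (Finset.mem_erase.1 ha).1
  obtain ⟨⟨ez, yz⟩, hez⟩ := Option.ne_none_iff_exists'.1
    (fun h0 => hak (hcomp (some (c, a)) z hz hzd h0).1)
  obtain ⟨⟨ew, yw⟩, hew⟩ := Option.ne_none_iff_exists'.1
    (fun h0 => hak (hcomp (some (c, a)) w hw hwd h0).1)
  -- The forest a is redirected at whichever of z, w has the higher rank in it, towards the other
  -- one; so it stays acyclic.
  rcases le_total (r (some (c, a)) z) (r (some (c, a)) w) with hr | hr
  · exact S.exists_complete_of_exchange hz hzd hw hwd hzw hak hcomp hinz hinw hh hg hfh hfg hew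
      (by rintro rfl; exact ha2 _ hew) hr
      (by intro c' j h; simp only [Option.some.injEq, Prod.mk.injEq] at h; rw [← h.1, hDg])
      (by
        intro c' j h
        simp only [Option.some.injEq, Prod.mk.injEq] at h
        rw [← h.1]
        exact ⟨hDh, S.orient hew⟩)
  · exact S.exists_complete_of_exchange hw hwd hz hzd hzw.symm hak
      (fun i' v hv hvd h => (hcomp i' v hv hvd h).imp id Or.symm) hinw hinz hg.symm hh.symm hfg hfh
      hez (by rintro rfl; exact ha1 _ hez) hr
      (by intro c' j h; simp only [Option.some.injEq, Prod.mk.injEq] at h; rw [← h.1, hDh])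
      (by
        intro c' j h
        simp only [Option.some.injEq, Prod.mk.injEq] at h
        rw [← h.1]
        exact ⟨hDg, S.orient hez⟩)

section TwoMissing

variable {g : β} {z w : α}

/-- The edge g serves in both directions: once for an exchanging forest of kind `true`, once for
`none`, which ignores orientations. Besides g there are at most m - 1 edges between z and w, so one
of the m forests of that kind uses no arc between them. -/
theorem exists_complete_of_none_missing (S : IsForestSystem (M.eraseEdge g) V d D q r)
    (hz : z ∈ V) (hzd : z ≠ d) (hw : w ∈ V) (hwd : w ≠ d) (hzw : z ≠ w) (hg : M.Links g z w)
    (hpar : (M.parallel z w).card ≤ m)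
    (hcomp : ∀ i', ∀ v ∈ V, v ≠ d → q i' v = none → i' = none ∧ (v = z ∨ v = w))
    (hinz : ∀ v e, q none v ≠ some (e, z)) (hinw : ∀ v e, q none v ≠ some (e, w)) :
    ∃ D' q' r', IsForestSystem (m := m) M V d D' q' r' ∧
      ∀ i, ∀ v ∈ V, v ≠ d → q' i v ≠ none := by
  have hgp := mem_parallel.2 hg
  have hcard := Finset.card_pos.2 ⟨g, hgp⟩
  obtain ⟨a, -, ha1, ha2⟩ := S.exists_avoiding hzw true Finset.univ ((M.parallel z w).erase g)
    (by
      rw [Finset.card_erase_of_mem hgp, Finset.card_univ, Fintype.card_fin]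
      omega)
    (by
      intro a ha e he
      rw [Finset.mem_erase, mem_parallel]
      rcases he with he | he
      · exact ⟨S.ne_erased he, (S.links he).of_eraseEdge⟩
      · exact ⟨S.ne_erased he, (S.links he).of_eraseEdge.symm⟩)
  have hak : (some (true, a) : Option (Bool × Fin m)) ≠ none := by simp
  obtain ⟨⟨ez, yz⟩, hez⟩ := Option.ne_none_iff_exists'.1
    (fun h0 => hak (hcomp (some (true, a)) z hz hzd h0).1)
  obtain ⟨⟨ew, yw⟩, hew⟩ := Option.ne_none_iff_exists'.1
    (fun h0 => hak (hcomp (some (true, a)) w hw hwd h0).1)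
  rcases le_total (r (some (true, a)) z) (r (some (true, a)) w) with hr | hr
  · obtain ⟨D', S', hD, -⟩ := S.addEdge hg.symm true
    refine ⟨D', S'.exists_complete_of_exchange hz hzd hw hwd hzw hak hcomp hinz hinw hg hg
      (fun i y h => S.ne_erased h rfl) (fun i y h => S.ne_erased h rfl) hew
      (by rintro rfl; exact ha2 _ hew) hr ?_ (by simp)⟩
    intro c' j h
    simp only [Option.some.injEq, Prod.mk.injEq] at h
    rw [← h.1, hD]
  · obtain ⟨D', S', hD, -⟩ := S.addEdge hg true
    refine ⟨D', S'.exists_complete_of_exchange hw hwd hz hzd hzw.symm hak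
      (fun i' v hv hvd h => (hcomp i' v hv hvd h).imp id Or.symm) hinw hinz hg.symm hg.symm
      (fun i y h => S.ne_erased h rfl) (fun i y h => S.ne_erased h rfl) hez
      (by rintro rfl; exact ha1 _ hez) hr ?_ (by simp)⟩
    intro c' j h
    simp only [Option.some.injEq, Prod.mk.injEq] at h
    rw [← h.1, hD]

/-- The forest `none` can spare its arc e at z, which is directed correctly for kind c, since it can
go along g to w instead, where its rank is no higher. The opposite direction of g is left to kind c.
-/
theorem exists_complete_of_some_missing_aux {c : Bool} {k : Fin m}
    (S : IsForestSystem (M.eraseEdge g) V d D q r)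
    (hz : z ∈ V) (hzd : z ≠ d) (hw : w ∈ V) (hwd : w ≠ d) (hzw : z ≠ w) (hg : M.Links g z w)
    (hpar : (M.parallel z w).card ≤ m)
    (hcomp : ∀ i', ∀ v ∈ V, v ≠ d → q i' v = none → i' = some (c, k) ∧ (v = z ∨ v = w))
    (hiz : q (some (c, k)) z = none) (hiw : q (some (c, k)) w = none)
    (hinz : ∀ v e, q (some (c, k)) v ≠ some (e, z)) (hinw : ∀ v e, q (some (c, k)) v ≠ some (e, w))
    {e : β} {y : α} (hC : q none z = some (e, y)) (hDe : D c e = z) (hr : r none w ≤ r none z) :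
    ∃ D' q' r', IsForestSystem (m := m) M V d D' q' r' ∧
      ∀ i, ∀ v ∈ V, v ≠ d → q' i v ≠ none := by
  obtain ⟨D', S', hDg, -, hD⟩ := S.addEdge hg.symm c
  have heg := S.ne_erased hC
  obtain ⟨r₁, S₁⟩ := S'.assign none hz hzd hw hg hzw (fun i y _ h => S.ne_erased h rfl) (by simp)
    (Or.inl hr)
  have hfree : ∀ i y', upd q none z (some (g, w)) i z ≠ some (e, y') := by
    intro i y' h
    rcases upd_eq_some h with ⟨h1, h2, h3⟩ | ⟨h1, h2⟩
    · simp only [Option.some.injEq, Prod.mk.injEq] at h3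
      exact heg h3.1.symm
    · exact h1 ⟨S.disj h2 hC, rfl⟩
  have hfg : ∀ i y', upd q none z (some (g, w)) i w ≠ some (g, y') := by
    intro i y' h
    rw [upd_of_ne_right _ _ _ _ hzw.symm] at h
    exact S.ne_erased h rfl
  have hs : ∀ v, upd q none z (some (g, w)) (some (c, k)) v = q (some (c, k)) v := fun v =>
    upd_of_ne_left _ _ _ _ (by simp)
  have hDe' : D' c e = z := (hD c e heg).trans hDe
  have hcomp₁ : ∀ i', ∀ v ∈ V, v ≠ d → upd q none z (some (g, w)) i' v = none →
      i' = some (c, k) ∧ (v = z ∨ v = w) := by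
    intro i' v hv hvd h
    unfold upd at h
    split_ifs at h
    exact hcomp i' v hv hvd h
  -- If e leads to w, giving both e and the arc of g from w to the missing forest would close a
  -- cycle, so another forest of kind c has to help. Otherwise both arcs can be assigned directly.
  by_cases hyw : y = w
  · subst hyw
    exact ⟨D', S₁.exists_complete_of_free_pair hz hzd hw hwd hzw hpar hcomp₁
      (by rw [hs, hiz]) (by rw [hs, hiw]) (fun v e => by rw [hs]; exact hinz v e)
      (fun v e => by rw [hs]; exact hinw v e) heg (S'.links hC) hg hDe' hDg hfree hfg⟩
  · obtain ⟨r₂, S₂⟩ := S₁.assign (some (c, k)) hz hzd (S.head_mem hC) (S'.links hC) (S.ne hC)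
      (fun i y' _ => hfree i y')
      (by
        intro c' j h
        simp only [Option.some.injEq, Prod.mk.injEq] at h
        rw [← h.1, hDe'])
      (Or.inr fun v e => by rw [hs]; exact hinz v e)
    obtain ⟨r₃, S₃⟩ := S₂.assign (some (c, k)) hw hwd hz hg.symm hzw.symm
      (fun i y' _ => by rw [upd_of_ne_right _ _ _ _ hzw.symm]; exact hfg i y')
      (by
        intro c' j h
        simp only [Option.some.injEq, Prod.mk.injEq] at h
        rw [← h.1, hDg])
      (by
        right
        intro u e' h
        rcases upd_eq_some h with ⟨-, h2, h3⟩ | ⟨h1, h2⟩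
        · simp only [Option.some.injEq, Prod.mk.injEq] at h3
          exact hyw h3.2
        · rw [hs] at h2
          exact hinw _ _ h2)
    refine ⟨D', _, r₃, S₃, fun i' v hv hvd h => ?_⟩
    unfold upd at h
    split_ifs at h with h1 h2 h3
    have := hcomp i' v hv hvd h
    tauto

theorem exists_complete_of_some_missing {c : Bool} {k : Fin m}
    (S : IsForestSystem (M.eraseEdge g) V d D q r)
    (hz : z ∈ V) (hzd : z ≠ d) (hw : w ∈ V) (hwd : w ≠ d) (hzw : z ≠ w) (hg : M.Links g z w)
    (hpar : (M.parallel z w).card ≤ m)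
    (hcomp : ∀ i', ∀ v ∈ V, v ≠ d → q i' v = none → i' = some (c, k) ∧ (v = z ∨ v = w))
    (hiz : q (some (c, k)) z = none) (hiw : q (some (c, k)) w = none)
    (hinz : ∀ v e, q (some (c, k)) v ≠ some (e, z)) (hinw : ∀ v e, q (some (c, k)) v ≠ some (e, w))
    (hCz : ∃ e y, q none z = some (e, y) ∧ D c e = z)
    (hCw : ∃ e y, q none w = some (e, y) ∧ D c e = w) :
    ∃ D' q' r', IsForestSystem (m := m) M V d D' q' r' ∧
      ∀ i, ∀ v ∈ V, v ≠ d → q' i v ≠ none := by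
  obtain ⟨e, y, hC, hDe⟩ := hCz
  obtain ⟨e', y', hC', hDe'⟩ := hCw
  rcases le_total (r none w) (r none z) with hr | hr
  · exact S.exists_complete_of_some_missing_aux hz hzd hw hwd hzw hg hpar hcomp hiz hiw hinz hinw
      hC hDe hr
  · exact S.exists_complete_of_some_missing_aux hw hwd hz hzd hzw.symm hg.symm
      (M.parallel_comm z w ▸ hpar) (fun i' v hv hvd h => (hcomp i' v hv hvd h).imp id Or.symm)
      hiw hiz hinw hinz hC' hDe' hr

/-- Two forests of one kind cannot use g in opposite directions. So `none` takes g from z to w and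
hands its arc e at z to the forest missing there; the other forest takes g from w to z. -/
theorem exists_complete_of_same_kind_aux {c : Bool} {k l : Fin m} (hkl : k ≠ l)
    (S : IsForestSystem (M.eraseEdge g) V d D q r)
    (hz : z ∈ V) (hzd : z ≠ d) (hw : w ∈ V) (hwd : w ≠ d) (hzw : z ≠ w) (hg : M.Links g z w)
    (hcomp : ∀ i', ∀ v ∈ V, v ≠ d → q i' v = none →
      (i' = some (c, k) ∧ v = w) ∨ (i' = some (c, l) ∧ v = z))
    (hinz : ∀ v e, q (some (c, l)) v ≠ some (e, z)) (hinw : ∀ v e, q (some (c, k)) v ≠ some (e, w))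
    {e : β} {y : α} (hC : q none z = some (e, y)) (hDe : D c e = z) (hr : r none w ≤ r none z) :
    ∃ D' q' r', IsForestSystem (m := m) M V d D' q' r' ∧
      ∀ i, ∀ v ∈ V, v ≠ d → q' i v ≠ none := by
  obtain ⟨D', S', hDg, -, hD⟩ := S.addEdge hg.symm c
  have heg := S.ne_erased hC
  obtain ⟨r₁, S₁⟩ := S'.assign none hz hzd hw hg hzw (fun i y _ h => S.ne_erased h rfl) (by simp)
    (Or.inl hr)
  have hs : ∀ k v, upd q none z (some (g, w)) (some (c, k)) v = q (some (c, k)) v := fun k v =>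
    upd_of_ne_left _ _ _ _ (by simp)
  obtain ⟨r₂, S₂⟩ := S₁.assign (some (c, l)) hz hzd (S.head_mem hC) (S'.links hC) (S.ne hC)
    (by
      intro i y' _ h
      rcases upd_eq_some h with ⟨h1, h2, h3⟩ | ⟨h1, h2⟩
      · simp only [Option.some.injEq, Prod.mk.injEq] at h3
        exact heg h3.1.symm
      · exact h1 ⟨S.disj h2 hC, rfl⟩)
    (by
      intro c' j h
      simp only [Option.some.injEq, Prod.mk.injEq] at h
      rw [← h.1, hD c e heg, hDe])
    (Or.inr fun v e => by rw [hs]; exact hinz v e)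
  obtain ⟨r₃, S₃⟩ := S₂.assign (some (c, k)) hw hwd hz hg.symm hzw.symm
    (fun i y' _ h => by
      rw [upd_of_ne_right _ _ _ _ hzw.symm, upd_of_ne_right _ _ _ _ hzw.symm] at h
      exact S.ne_erased h rfl)
    (by
      intro c' j h
      simp only [Option.some.injEq, Prod.mk.injEq] at h
      rw [← h.1, hDg])
    (by
      right
      intro u e' h
      rw [upd_of_ne_left _ _ _ _ (by simpa using hkl), hs] at h
      exact hinw _ _ h)
  refine ⟨D', _, r₃, S₃, fun i' v hv hvd h => ?_⟩
  unfold upd at h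
  split_ifs at h with h1 h2 h3
  have := hcomp i' v hv hvd h
  tauto

/-- The forest `i` has no arc at `w`, and `j` has no arc at `z`. Both arcs can be supplied
by means of an additional edge `g` between `z` and `w`. -/
theorem exists_complete_of_two_missing {i j : Option (Bool × Fin m)}
    (S : IsForestSystem (M.eraseEdge g) V d D q r)
    (hz : z ∈ V) (hzd : z ≠ d) (hw : w ∈ V) (hwd : w ≠ d) (hzw : z ≠ w) (hg : M.Links g z w)
    (hpar : (M.parallel z w).card ≤ m)
    (hcomp : ∀ i', ∀ v ∈ V, v ≠ d → q i' v = none → (i' = i ∧ v = w) ∨ (i' = j ∧ v = z))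
    (hiw : q i w = none) (hjz : q j z = none)
    (hinz : ∀ v e, q j v ≠ some (e, z)) (hinw : ∀ v e, v ≠ z → q i v ≠ some (e, w))
    (hiz : ∀ e, q i z = some (e, w) → i ≠ none ∧ ∀ v e', q i v ≠ some (e', z))
    (hCz : ∀ c k, j = some (c, k) → ∃ e y, q none z = some (e, y) ∧ D c e = z)
    (hCw : ∀ c k, i = some (c, k) → ∃ e y, q none w = some (e, y) ∧ D c e = w) :
    ∃ D' q' r', IsForestSystem (m := m) M V d D' q' r' ∧
      ∀ i, ∀ v ∈ V, v ≠ d → q' i v ≠ none := by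
  by_cases hij : i = j
  · subst hij
    have hinw' : ∀ v e, q i v ≠ some (e, w) := by
      intro v e h
      by_cases hv : v = z
      · rw [hv, hjz] at h
        cases h
      · exact hinw v e hv h
    have hcomp' : ∀ i', ∀ v ∈ V, v ≠ d → q i' v = none → i' = i ∧ (v = z ∨ v = w) := by
      intro i' v hv hvd h
      have := hcomp i' v hv hvd h
      tauto
    rcases i with _ | ⟨c, k⟩
    · exact S.exists_complete_of_none_missing hz hzd hw hwd hzw hg hpar hcomp' hinz hinw'
    · exact S.exists_complete_of_some_missing hz hzd hw hwd hzw hg hpar hcomp' hjz hiw hinz hinw'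
        (hCz c k rfl) (hCw c k rfl)
  -- An arc h of i from z to w would form a cycle with g taken from w to z. It is removed: then i
  -- lacks arcs at both vertices and enters neither, and h becomes free.
  by_cases hK : ∃ h, q i z = some (h, w)
  · obtain ⟨h, hh⟩ := hK
    obtain ⟨hi, hinz'⟩ := hiz h hh
    obtain ⟨⟨c, k⟩, rfl⟩ := Option.ne_none_iff_exists'.1 hi
    have S₁ := S.unassign (some (c, k)) z
    have hin₁ : ∀ v e, upd q (some (c, k)) z none (some (c, k)) v ≠ some (e, w) := by
      intro v e h
      rcases upd_eq_some h with ⟨-, -, h⟩ | ⟨h1, h2⟩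
      · cases h
      · exact hinw v e (fun hv => h1 ⟨rfl, hv⟩) h2
    have hin₂ : ∀ v e, upd q (some (c, k)) z none (some (c, k)) v ≠ some (e, z) := by
      intro v e h
      rcases upd_eq_some h with ⟨-, -, h⟩ | ⟨h1, h2⟩
      · cases h
      · exact hinz' v e h2
    have hin₃ : ∀ v e, upd q (some (c, k)) z none j v ≠ some (e, z) := by
      intro v e h
      rw [upd_of_ne_left _ _ _ _ (Ne.symm hij)] at h
      exact hinz v e h
    have hfh : ∀ i y, upd q (some (c, k)) z none i z ≠ some (h, y) := by
      intro i y h'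
      rcases upd_eq_some h' with ⟨-, -, h'⟩ | ⟨h1, h2⟩
      · cases h'
      · exact h1 ⟨S.disj h2 hh, rfl⟩
    -- If j is of the same kind as i, it may take over h at z, and only i is left with missing arcs.
    by_cases hj : ∃ l, j = some (c, l)
    · obtain ⟨l, rfl⟩ := hj
      obtain ⟨r₂, S₂⟩ := S₁.assign (some (c, l)) hz hzd hw (S.links hh) hzw
        (fun i y _ => hfh i y)
        (by
          intro c' j h
          simp only [Option.some.injEq, Prod.mk.injEq] at h
          rw [← h.1]
          exact S.orient hh)
        (Or.inr hin₃)
      have hs : ∀ v, upd (upd q (some (c, k)) z none) (some (c, l)) z (some (h, w)) (some (c, k)) v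
          = upd q (some (c, k)) z none (some (c, k)) v := fun v => upd_of_ne_left _ _ _ _ hij
      have hn : ∀ v, upd (upd q (some (c, k)) z none) (some (c, l)) z (some (h, w)) none v
          = q none v := fun v => by
        rw [upd_of_ne_left _ _ _ _ (by simp), upd_of_ne_left _ _ _ _ (by simp)]
      refine S₂.exists_complete_of_some_missing (c := c) (k := k) hz hzd hw hwd hzw hg hpar ?_
        (by rw [hs, upd_self]) (by rw [hs, upd_of_ne_right _ _ _ _ hzw.symm, hiw])
        (fun v e => by rw [hs]; exact hin₂ v e) (fun v e => by rw [hs]; exact hin₁ v e)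
        (by simpa only [hn] using hCz c l rfl) (by simpa only [hn] using hCw c k rfl)
      intro i' v hv hvd h0
      unfold upd at h0
      split_ifs at h0 with h1 h2
      · exact ⟨h2.1, Or.inl h2.2⟩
      · have := hcomp i' v hv hvd h0
        tauto
    -- Otherwise j takes g from z to w, and for kind c there remain two free arcs: h from z and g
    -- from w.
    · obtain ⟨D', S₂, hDg, hDg', hD⟩ := S₁.addEdge hg.symm c
      obtain ⟨r₃, S₃⟩ := S₂.assign j hz hzd hw hg hzw
        (fun i y _ h => S₁.ne_erased h rfl)
        (by
          rintro c' l rfl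
          have : c' = !c := by
            have : c' ≠ c := by
              rintro rfl
              exact hj ⟨l, rfl⟩
            cases c <;> cases c' <;> simp_all
          rw [this, hDg'])
        (Or.inr hin₃)
      have hhg := S.ne_erased hh
      have hs : ∀ v, upd (upd q (some (c, k)) z none) j z (some (g, w)) (some (c, k)) v
          = upd q (some (c, k)) z none (some (c, k)) v := fun v => upd_of_ne_left _ _ _ _ hij
      refine ⟨D', S₃.exists_complete_of_free_pair (c := c) (k := k) hz hzd hw hwd hzw hpar ?_
        (by rw [hs, upd_self]) (by rw [hs, upd_of_ne_right _ _ _ _ hzw.symm, hiw])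
        (fun v e => by rw [hs]; exact hin₂ v e) (fun v e => by rw [hs]; exact hin₁ v e)
        hhg (S.links hh).of_eraseEdge hg ((hD c h hhg).trans (S.orient hh)) hDg ?_ ?_⟩
      · intro i' v hv hvd h0
        unfold upd at h0
        split_ifs at h0 with h1 h2
        · exact ⟨h2.1, Or.inl h2.2⟩
        · have := hcomp i' v hv hvd h0
          tauto
      · intro i' y h'
        rcases upd_eq_some h' with ⟨-, -, h'⟩ | ⟨h1, h2⟩
        · simp only [Option.some.injEq, Prod.mk.injEq] at h'
          exact hhg h'.1.symm
        · exact hfh i' y h2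
      · intro i' y h'
        rw [upd_of_ne_right _ _ _ _ hzw.symm] at h'
        exact S₁.ne_erased h' rfl
  have hinw' : ∀ v e, q i v ≠ some (e, w) := by
    intro v e h
    by_cases hv : v = z
    · exact hK ⟨e, hv ▸ h⟩
    · exact hinw v e hv h
  by_cases hsame : ∃ c k l, i = some (c, k) ∧ j = some (c, l)
  · obtain ⟨c, k, l, rfl, rfl⟩ := hsame
    have hkl : k ≠ l := by
      rintro rfl
      exact hij rfl
    obtain ⟨e, y, hC, hDe⟩ := hCz c l rfl
    obtain ⟨e', y', hC', hDe'⟩ := hCw c k rfl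
    rcases le_total (r none w) (r none z) with hr | hr
    · exact S.exists_complete_of_same_kind_aux hkl hz hzd hw hwd hzw hg hcomp hinz hinw' hC hDe hr
    · exact S.exists_complete_of_same_kind_aux hkl.symm hw hwd hz hzd hzw.symm hg.symm
        (fun i' v hv hvd h => (hcomp i' v hv hvd h).symm) hinw' hinz hC' hDe' hr
  -- The forests are of different kinds, or one of them is `none`; so g can be used by j from z and
  -- by i from w without violating orientations.
  · have : ∃ b : Bool, (∀ c k, j = some (c, k) → c = b) ∧ ∀ c k, i = some (c, k) → c = !b := by
      rcases i with _ | ⟨c, k⟩ <;> rcases j with _ | ⟨c', k'⟩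
      · exact absurd rfl hij
      · exact ⟨c', by simp, by simp⟩
      · exact ⟨!c, by simp, by simp⟩
      · have hcc : c ≠ c' := by
          rintro rfl
          exact hsame ⟨c, k, k', rfl, rfl⟩
        refine ⟨c', by simp, ?_⟩
        cases c <;> cases c' <;> simp_all
    obtain ⟨b, hbj, hbi⟩ := this
    obtain ⟨D', S', hD1, hD2, -⟩ := S.addEdge hg b
    obtain ⟨r₁, S₁⟩ := S'.assign j hz hzd hw hg hzw (fun i y _ h => S.ne_erased h rfl)
      (fun c k h => by rw [hbj c k h, hD1]) (Or.inr hinz)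
    obtain ⟨r₂, S₂⟩ := S₁.assign i hw hwd hz hg.symm hzw.symm
      (fun i y _ h => by
        rw [upd_of_ne_right _ _ _ _ hzw.symm] at h
        exact S.ne_erased h rfl)
      (fun c k h => by rw [hbi c k h, hD2])
      (Or.inr fun u e' h => by
        rw [upd_of_ne_left _ _ _ _ hij] at h
        exact hinw' _ _ h)
    refine ⟨D', _, r₂, S₂, fun i' v hv hvd h => ?_⟩
    unfold upd at h
    split_ifs at h with h1 h2
    have := hcomp i' v hv hvd h
    tauto

end TwoMissing

end IsForestSystem

/-! ### Tight sets -/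

/-- Every cut of `M`, as a multigraph on `V`, has at least `k` edges. -/
def CutCondition (M : FinMultigraph α β) (V : Finset α) (k : ℕ) : Prop :=
  ∀ X ⊆ V, X.Nonempty → X ≠ V → k ≤ M.cut X

/-- `X` is a set of vertices without the root `d` that is left by exactly `k` edges. -/
structure IsTight (M : FinMultigraph α β) (V : Finset α) (d : α) (k : ℕ) (X : Finset α) :
    Prop where
  subset : X ⊆ V
  notMem : d ∉ X
  nonempty : X.Nonempty
  cut_eq : M.cut X = k

theorem cut_eraseEdge (M : FinMultigraph α β) {g : β} (hg : g ∈ M.edges) (X : Finset α) :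
    (M.eraseEdge g).cut X + cross (M.fst g) (M.snd g) X = M.cut X := by
  simp only [cut, eraseEdge]
  rw [← Finset.add_sum_erase _ _ hg, add_comm]

theorem cut_sdiff_eq {M : FinMultigraph α β} {V : Finset α} (hM : M.EndsIn V) (X : Finset α) :
    M.cut (V \ X) = M.cut X := by
  refine Finset.sum_congr rfl fun e he => ?_
  obtain ⟨h1, h2⟩ := hM e he
  simp only [cross, Finset.mem_sdiff, h1, h2, true_and, not_iff_not]

theorem cross_sdiff_eq {M : FinMultigraph α β} {V : Finset α} (hM : M.EndsIn V) {e : β}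
    (he : e ∈ M.edges) (X : Finset α) :
    cross (M.fst e) (M.snd e) (V \ X) = cross (M.fst e) (M.snd e) X := by
  obtain ⟨h1, h2⟩ := hM e he
  simp only [cross, Finset.mem_sdiff, h1, h2, true_and, not_iff_not]

theorem cross_le_one (u v : α) (X : Finset α) : cross u v X ≤ 1 := by
  unfold cross
  split_ifs <;> simp

theorem cut_singleton_add (M : FinMultigraph α β) {z w : α} (hzw : z ≠ w) :
    M.cut {z} + M.cut {w} = M.cut {z, w} + 2 * (M.parallel z w).card := by
  classical
  simp only [parallel, Finset.card_filter, cut, Finset.mul_sum, ← Finset.sum_add_distrib]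
  refine Finset.sum_congr rfl fun e he => ?_
  simp only [cross, Links, he, true_and, Finset.mem_insert, Finset.mem_singleton]
  grind

theorem cut_add_cut_le_of_forall (M : FinMultigraph α β) {X Y : Finset α} (h : Disjoint X Y)
    (hM : ∀ e ∈ M.edges, ¬ (M.fst e ∈ X ∪ Y ∧ M.snd e ∈ X ∪ Y)) :
    M.cut X + M.cut Y ≤ M.cut (X ∪ Y) := by
  simp only [cut, ← Finset.sum_add_distrib]
  refine Finset.sum_le_sum fun e he => ?_
  have h1 : ∀ u ∈ X, u ∉ Y := fun u hu => Finset.disjoint_left.1 h hu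
  have h2 := hM e he
  simp only [cross, Finset.mem_union] at *
  grind

namespace CutCondition

variable {M : FinMultigraph α β} {V : Finset α} {d : α} {k : ℕ}

theorem le_cut (hc : M.CutCondition V k) (hd : d ∈ V) {X : Finset α} (hX : X ⊆ V)
    (hdX : d ∉ X) (hn : X.Nonempty) : k ≤ M.cut X :=
  hc X hX hn fun h => hdX (h ▸ hd)

theorem exists_isTight (hc : M.CutCondition V k) (hM : M.EndsIn V) {g : β} (hg : g ∈ M.edges)
    (h : ¬ (M.eraseEdge g).CutCondition V k) :
    ∃ X, M.IsTight V d k X ∧ cross (M.fst g) (M.snd g) X = 1 := by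
  simp only [CutCondition] at h
  push Not at h
  obtain ⟨X, hX, hXn, hXV, hlt⟩ := h
  have h1 := M.cut_eraseEdge hg X
  have h2 := hc X hX hXn hXV
  have h3 := cross_le_one (M.fst g) (M.snd g) X
  -- X and its complement have the same cut; the one avoiding d is taken.
  by_cases hdX : d ∈ X
  · refine ⟨V \ X, ⟨Finset.sdiff_subset, fun h => (Finset.mem_sdiff.1 h).2 hdX, ?_, ?_⟩, ?_⟩
    · rw [Finset.sdiff_nonempty]
      exact fun h => hXV (hX.antisymm h)
    · rw [cut_sdiff_eq hM]
      omega
    · rw [cross_sdiff_eq hM hg]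
      omega
  · exact ⟨X, ⟨hX, hdX, hXn, by omega⟩, by omega⟩

/-- Without inner edges the cuts of {v} and of X \ {v}, each at least k, would add up to at most the
cut k of X. -/
theorem exists_inner_edge (hc : M.CutCondition V k) (hd : d ∈ V) (hk : 1 ≤ k) {X : Finset α}
    (hX : M.IsTight V d k X) (h2 : 2 ≤ X.card) :
    ∃ g ∈ M.edges, M.fst g ∈ X ∧ M.snd g ∈ X := by
  by_contra! hno
  obtain ⟨v, hv⟩ := hX.nonempty
  have hu : {v} ∪ X.erase v = X := by
    rw [← Finset.insert_eq, Finset.insert_erase hv]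
  have h1 := M.cut_add_cut_le_of_forall (X := {v}) (Y := X.erase v) (by simp)
    (by rw [hu]; exact fun e he h => hno e he h.1 h.2)
  rw [hu, hX.cut_eq] at h1
  have h3 := hc.le_cut hd (X := {v}) (by simpa using hX.subset hv)
    (by rw [Finset.mem_singleton]; rintro rfl; exact hX.notMem hv) (by simp)
  have h4 := hc.le_cut hd (X := X.erase v) ((Finset.erase_subset _ _).trans hX.subset)
    (fun h => hX.notMem (Finset.mem_of_mem_erase h))
    (Finset.card_pos.1 (by rw [Finset.card_erase_of_mem hv]; omega))
  omega

/-- Submodularity; the union is a proper subset because it avoids d. -/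
theorem isTight_inter (hc : M.CutCondition V k) (hd : d ∈ V) {X Y : Finset α}
    (hX : M.IsTight V d k X) (hY : M.IsTight V d k Y) (h : (X ∩ Y).Nonempty) :
    M.IsTight V d k (X ∩ Y) := by
  have h1 := M.cut_inter_add_cut_union_le X Y
  have h2 := hc.le_cut hd (Finset.union_subset hX.subset hY.subset)
    (by simp [hX.notMem, hY.notMem]) (hX.nonempty.mono Finset.subset_union_left)
  have h3 : d ∉ X ∩ Y := by simp [hX.notMem]
  have h4 := hc.le_cut hd (Finset.inter_subset_left.trans hX.subset) h3 h
  rw [hX.cut_eq, hY.cut_eq] at h1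
  exact ⟨Finset.inter_subset_left.trans hX.subset, h3, h, by omega⟩

theorem isTight_sdiff (hc : M.CutCondition V k) (hd : d ∈ V) {X Y : Finset α}
    (hX : M.IsTight V d k X) (hY : M.IsTight V d k Y) (h : (X \ Y).Nonempty)
    (h' : (Y \ X).Nonempty) : M.IsTight V d k (X \ Y) := by
  have h1 := M.cut_sdiff_add_cut_sdiff_le X Y
  have h2 := hc.le_cut hd (Finset.sdiff_subset.trans hY.subset) (by simp [hY.notMem]) h'
  have h3 : d ∉ X \ Y := by simp [hX.notMem]
  have h4 := hc.le_cut hd (Finset.sdiff_subset.trans hX.subset) h3 h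
  rw [hX.cut_eq, hY.cut_eq] at h1
  exact ⟨Finset.sdiff_subset.trans hX.subset, h3, h, by omega⟩

/-- If X and Y crossed, X ∩ Y and X \ Y would both be tight. Their cuts sum to 2k, which differs
from the cut k of their union X by an even number; this is impossible for odd k. -/
theorem subset_or_subset (hc : M.CutCondition V k) (hd : d ∈ V) (hk : Odd k) {X Y : Finset α}
    (hX : M.IsTight V d k X) (hY : M.IsTight V d k Y) (h : (X ∩ Y).Nonempty) :
    X ⊆ Y ∨ Y ⊆ X := by
  by_contra! hcon
  have h1 := hc.isTight_inter hd hX hY h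
  have h2 := hc.isTight_sdiff hd hX hY (Finset.sdiff_nonempty.2 hcon.1)
    (Finset.sdiff_nonempty.2 hcon.2)
  obtain ⟨q, hq⟩ := M.exists_cut_union_add (Finset.disjoint_sdiff_inter X Y)
  rw [Finset.sdiff_union_inter, h1.cut_eq, h2.cut_eq, hX.cut_eq] at hq
  obtain ⟨a, ha⟩ := hk
  omega

/-- A smallest tight set with two vertices would have an inner edge, crossed by a tight set Y, and
its intersection with Y would be a smaller tight set. -/
theorem exists_isTight_singleton (hc : M.CutCondition V k) (hd : d ∈ V) (hk : 1 ≤ k)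
    (hmin : ∀ g ∈ M.edges, ∃ X, M.IsTight V d k X ∧ cross (M.fst g) (M.snd g) X = 1)
    (hne : M.edges.Nonempty) : ∃ z, M.IsTight V d k {z} := by
  obtain ⟨g₀, hg₀⟩ := hne
  obtain ⟨X, hX, hXmin⟩ := exists_minimal_image (fun X => M.IsTight V d k X) Finset.card
    ((hmin g₀ hg₀).imp fun _ h => h.1)
  by_cases h2 : 2 ≤ X.card
  · obtain ⟨g, hg, h1, h3⟩ := hc.exists_inner_edge hd hk hX h2
    obtain ⟨Y, hY, hcr⟩ := hmin g hg
    have hXY : (X ∩ Y).Nonempty ∧ X ∩ Y ≠ X := by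
      simp only [cross] at hcr
      constructor
      · by_cases h4 : M.fst g ∈ Y
        · exact ⟨_, Finset.mem_inter.2 ⟨h1, h4⟩⟩
        · exact ⟨M.snd g, Finset.mem_inter.2 ⟨h3, by grind⟩⟩
      · rw [Ne, Finset.inter_eq_left]
        intro h
        simp [h h1, h h3] at hcr
    have h4 := hXmin _ (hc.isTight_inter hd hX hY hXY.1)
    have h5 := Finset.card_lt_card (Finset.inter_subset_left.ssubset_of_ne hXY.2)
    omega
  · have h1 := Finset.card_pos.2 hX.nonempty
    obtain ⟨z, rfl⟩ := Finset.card_eq_one.1 (show X.card = 1 by omega)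
    exact ⟨z, hX⟩

/-- An inner edge of a smallest tight set X with at least two vertices works: a
larger-than-singleton tight set crossing it would, by laminarity, lie strictly inside X. If all
tight sets are singletons, any edge works. -/
theorem exists_edge_tight_singleton (hc : M.CutCondition V k) (hd : d ∈ V) (hk : Odd k)
    (hne : M.edges.Nonempty) :
    ∃ g ∈ M.edges, ∀ X, M.IsTight V d k X → cross (M.fst g) (M.snd g) X = 1 → X.card = 1 := by
  have hsmall : ∀ X, M.IsTight V d k X → ¬ 2 ≤ X.card → X.card = 1 := fun X hX h2 => by
    have h1 := Finset.card_pos.2 hX.nonempty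
    omega
  by_cases h : ∃ X, M.IsTight V d k X ∧ 2 ≤ X.card
  · obtain ⟨X, ⟨hX, h2⟩, hXmin⟩ := exists_minimal_image _ Finset.card h
    obtain ⟨g, hg, h1, h3⟩ := hc.exists_inner_edge hd hk.pos hX h2
    refine ⟨g, hg, fun Y hY hcr => hsmall Y hY fun hY2 => ?_⟩
    have hXY : (X ∩ Y).Nonempty ∧ ¬ X ⊆ Y := by
      simp only [cross] at hcr
      constructor
      · by_cases h4 : M.fst g ∈ Y
        · exact ⟨_, Finset.mem_inter.2 ⟨h1, h4⟩⟩
        · exact ⟨M.snd g, Finset.mem_inter.2 ⟨h3, by grind⟩⟩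
      · intro h
        simp [h h1, h h3] at hcr
    rcases hc.subset_or_subset hd hk hX hY hXY.1 with h4 | h4
    · exact hXY.2 h4
    · have h5 := hXmin Y ⟨hY, hY2⟩
      have h6 := Finset.card_lt_card (h4.ssubset_of_ne fun h => hXY.2 h.ge)
      omega
  · obtain ⟨g, hg⟩ := hne
    exact ⟨g, hg, fun X hX _ => hsmall X hX fun h2 => h ⟨X, hX, h2⟩⟩

theorem edges_nonempty (hc : M.CutCondition V k) (hk : 1 ≤ k) {v : α} (hv : v ∈ V) (hvd : v ≠ d)
    (hd : d ∈ V) : M.edges.Nonempty := by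
  by_contra h
  rw [Finset.not_nonempty_iff_eq_empty] at h
  have := hc.le_cut hd (X := {v}) (by simpa using hv) (by simpa using hvd.symm) (by simp)
  simp [cut, h] at this
  omega

end CutCondition

theorem EndsIn.eraseEdge {M : FinMultigraph α β} {V : Finset α} (hM : M.EndsIn V) (g : β) :
    (M.eraseEdge g).EndsIn V :=
  fun e he => hM e (Finset.mem_of_mem_erase he)

theorem exists_empty_forestSystem (M : FinMultigraph α β) (V : Finset α) (d : α) (m : ℕ) :
    ∃ D r, IsForestSystem (m := m) M V d D (fun _ _ => none) r := by
  refine ⟨fun b e => if b then M.fst e else M.snd e, fun _ _ => 0, ?_⟩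
  refine ⟨by simp, by simp, by simp, by simp, by simp, by simp, by simp, ?_⟩
  intro e x y h
  exact ⟨h.1, Or.inl ⟨rfl, rfl⟩⟩

/-! ### The inductions for even and odd connectivity -/

theorem four_mul_gt {m k : ℕ} (h : k = 2 * m ∨ k = 2 * m + 1) (hm : 0 < m) :
    3 * k + 1 < k + k + k + k := by
  omega

theorem exists_forestSystem_even {d : α} (hm : 1 ≤ m) : ∀ (n : ℕ) (V : Finset α)
    (M : FinMultigraph α β), V.card + M.edges.card = n → M.EndsIn V → d ∈ V →
    M.CutCondition V (2 * m) →
    ∃ D q r, IsForestSystem (m := m) M V d D q r ∧ (∀ v, q none v = none) ∧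
      ∀ i, i ≠ none → ∀ v ∈ V, v ≠ d → q i v ≠ none := by
  intro n
  induction n using Nat.strong_induction_on with
  | _ n ih =>
  intro V M hn hM hd hc
  by_cases hdel : ∃ g ∈ M.edges, (M.eraseEdge g).CutCondition V (2 * m)
  · obtain ⟨g, hg, hgc⟩ := hdel
    obtain ⟨D, q, r, S, h1, h2⟩ := ih _ (by
      have : (M.eraseEdge g).edges.card < M.edges.card := Finset.card_erase_lt_of_mem hg
      omega) V (M.eraseEdge g) rfl (hM.eraseEdge g) hd hgc
    obtain ⟨D', S', -⟩ := S.addEdge (x := M.fst g) (y := M.snd g) ⟨hg, Or.inl ⟨rfl, rfl⟩⟩ true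
    exact ⟨D', q, r, S', h1, h2⟩
  push Not at hdel
  by_cases hV : ∀ v ∈ V, v = d
  · obtain ⟨D, r, S⟩ := M.exists_empty_forestSystem V d m
    exact ⟨D, _, r, S, fun _ => rfl, fun i _ v hv hvd => absurd (hV v hv) hvd⟩
  push Not at hV
  obtain ⟨v, hv, hvd⟩ := hV
  obtain ⟨z, hz⟩ := hc.exists_isTight_singleton hd (by omega)
    (fun g hg => hc.exists_isTight hM hg (hdel g hg)) (hc.edges_nonempty (by omega) hv hvd hd)
  have hzV : z ∈ V := hz.subset (Finset.mem_singleton_self z)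
  have hzd : z ≠ d := by
    rintro rfl
    exact hz.notMem (Finset.mem_singleton_self _)
  obtain ⟨H, P, f, hS, hH⟩ := exists_completeSplitting (Finset.notMem_erase z V) (2 * m)
    (fun _ => 2 * m) (fun _ => le_rfl) (fun _ _ => rfl) m
    (fun hm _ _ _ _ _ _ _ _ _ _ _ _ _ _ _ _ _ _ => four_mul_gt (Or.inl rfl) hm) M
    (by rwa [Finset.insert_erase hzV])
    (fun X hX hXn hXV => hc.le_cut hzV (hX.trans (Finset.erase_subset _ _))
      (fun h => Finset.notMem_erase z V (hX h)) hXn) hz.cut_eq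
  have hdV : d ∈ V.erase z := Finset.mem_erase.2 ⟨hzd.symm, hd⟩
  obtain ⟨D, q, r, S, h1, h2⟩ := ih _ (by
    have h3 := Finset.card_erase_lt_of_mem hzV
    have h4 := Finset.card_le_card hS.edges_subset
    omega) (V.erase z) H rfl hS.endsIn hdV hH
  obtain ⟨D', q', r', i₀, S', hA, hB, -, -, hE, -⟩ :=
    S.exists_pinch (Finset.notMem_erase z V) hzd hS hz.cut_eq
  rw [Finset.insert_erase hzV] at S'
  -- A forest other than `none` is deprived at z only in favour of `none`, which has no arcs here.
  have hi₀ : i₀ = none := by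
    rcases i₀ with _ | ⟨c, j⟩
    · rfl
    · obtain ⟨⟨v, hv⟩, -⟩ := hE c j rfl
      exact absurd (h1 v) hv
  subst hi₀
  refine ⟨D', q', r', S', fun v => ?_, fun i hi v hv hvd h => ?_⟩
  · by_cases hvz : v = z
    · rw [hvz, hB]
    · rw [hA _ _ hvz, h1]
  · by_cases hvz : v = z
    · rw [hvz, hB] at h
      exact hi h
    · rw [hA _ _ hvz] at h
      exact h2 i hi v (Finset.mem_erase.2 ⟨hvz, hv⟩) hvd h

/-- In the splitting of `z`, the degree of `w` need only be `2 * m`. -/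
theorem exceptional_sum_gt {V : Finset α} {w : α} {m : ℕ} (hm : 0 < m) (R : Finset α → ℕ)
    (hR : ∀ X, R X = if X = {w} ∨ X = V.erase w then 2 * m else 2 * m + 1)
    (A B C D : Finset α) (hA : A ⊆ V) (hB : B ⊆ V) (hC : C ⊆ V) (_ : D ⊆ V)
    (nA : A.Nonempty) (nB : B.Nonempty) (nC : C.Nonempty) (_ : D.Nonempty)
    (hAB : Disjoint A B) (hAC : Disjoint A C) (hAD : Disjoint A D) (hBC : Disjoint B C)
    (hBD : Disjoint B D) (hCD : Disjoint C D) :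
    3 * (2 * m + 1) + 1 < R A + R B + R C + R D := by
  have key' : ∀ X Z : Finset α, X = {w} → Z ⊆ V → Z.Nonempty → Disjoint X Z →
      Disjoint (V.erase w) Z → False := by
    rintro X Z rfl hZ ⟨x, hx⟩ h1 h2
    have h3 := Finset.disjoint_right.1 h1 hx
    rw [Finset.mem_singleton] at h3
    exact Finset.disjoint_right.1 h2 hx (Finset.mem_erase.2 ⟨h3, hZ hx⟩)
  have key : ∀ X Y Z : Finset α, X.Nonempty → Z ⊆ V → Z.Nonempty → Disjoint X Y → Disjoint X Z →
      Disjoint Y Z → (X = {w} ∨ X = V.erase w) → (Y = {w} ∨ Y = V.erase w) → False := by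
    rintro X Y Z hX hZV hZ hXY hXZ hYZ (h | h) (h' | h')
    · rw [h, h'] at hXY
      simp at hXY
    · exact key' X Z h hZV hZ hXZ (h' ▸ hYZ)
    · exact key' Y Z h' hZV hZ hYZ (h ▸ hXZ)
    · rw [h'.trans h.symm, disjoint_self] at hXY
      exact hX.ne_empty hXY
  have k1 := key A B C nA hC nC hAB hAC hBC
  have k2 := key A C B nA hB nB hAC hAB hBC.symm
  have k3 := key A D B nA hB nB hAD hAB hBD.symm
  have k4 := key B C A nB hA nA hBC hAB.symm hAC.symm
  have k5 := key B D A nB hA nA hBD hAB.symm hAD.symm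
  have k6 := key C D A nC hA nA hCD hAC.symm hAD.symm
  have hge : ∀ X, 2 * m ≤ R X := fun X => by
    rw [hR]
    split_ifs <;> omega
  have heq : ∀ X, ¬ (X = {w} ∨ X = V.erase w) → R X = 2 * m + 1 := fun X h => by
    rw [hR, if_neg h]
  have gA := hge A
  have gB := hge B
  have gC := hge C
  have gD := hge D
  by_cases eA : A = {w} ∨ A = V.erase w
  · have := heq B (k1 eA)
    have := heq C (k2 eA)
    have := heq D (k3 eA)
    omega
  by_cases eB : B = {w} ∨ B = V.erase w
  · have := heq A eA
    have := heq C (k4 eB)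
    have := heq D (k5 eB)
    omega
  by_cases eC : C = {w} ∨ C = V.erase w
  · have := heq A eA
    have := heq B eB
    have := heq D (k6 eC)
    omega
  have := heq A eA
  have := heq B eB
  have := heq C eC
  omega

/-- Deleting an edge `g` which is crossed only by singletons among the tight sets affects only the
cuts around its ends. -/
theorem CutCondition.le_cut_eraseEdge {M : FinMultigraph α β} {V : Finset α} {d : α} {k : ℕ}
    (hc : M.CutCondition V k) (hM : M.EndsIn V) {g : β} (hg : g ∈ M.edges)
    (hsing : ∀ X, M.IsTight V d k X → cross (M.fst g) (M.snd g) X = 1 → X.card = 1)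
    {X : Finset α} (hX : X ⊆ V) (hn : X.Nonempty) (hXV : X ≠ V)
    (h1 : cross (M.fst g) (M.snd g) X = 1 → X.card ≠ 1 ∨ ¬ M.IsTight V d k X)
    (h2 : cross (M.fst g) (M.snd g) X = 1 → (V \ X).card ≠ 1 ∨ ¬ M.IsTight V d k (V \ X)) :
    k ≤ (M.eraseEdge g).cut X := by
  by_contra hlt
  have h3 := M.cut_eraseEdge hg X
  have h4 := hc X hX hn hXV
  have h5 := cross_le_one (M.fst g) (M.snd g) X
  have h6 : cross (M.fst g) (M.snd g) X = 1 := by omega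
  have h7 : M.cut X = k := by omega
  by_cases hdX : d ∈ X
  · have ht : M.IsTight V d k (V \ X) := by
      refine ⟨Finset.sdiff_subset, fun h => (Finset.mem_sdiff.1 h).2 hdX, ?_, ?_⟩
      · rw [Finset.sdiff_nonempty]
        exact fun h => hXV (hX.antisymm h)
      · rw [cut_sdiff_eq hM, h7]
    have h8 := hsing _ ht (by rw [cross_sdiff_eq hM hg, h6])
    rcases h2 h6 with h | h
    · exact h h8
    · exact h ht
  · have ht : M.IsTight V d k X := ⟨hX, hdX, hn, h7⟩
    have h8 := hsing _ ht h6
    rcases h1 h6 with h | h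
    · exact h h8
    · exact h ht

theorem Links.cross_eq_one_iff {M : FinMultigraph α β} {e : β} {u v : α} (h : M.Links e u v)
    (X : Finset α) : cross (M.fst e) (M.snd e) X = 1 ↔ ¬ (u ∈ X ↔ v ∈ X) := by
  rw [h.cross_eq]
  unfold cross
  split_ifs with h <;> simp [h]

theorem card_erase_add_lt {M N : FinMultigraph α β} {V W : Finset α} {z : α} (hz : z ∈ V)
    (hW : W ⊆ V.erase z) (h : N.edges ⊆ M.edges) :
    W.card + N.edges.card < V.card + M.edges.card := by
  have h1 := Finset.card_erase_lt_of_mem hz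
  have h2 := Finset.card_le_card h
  have h3 := Finset.card_le_card hW
  omega

/-- Splitting off requires even degree, so an edge g at the tight vertex z is set aside first. All
2m + 1 forests are needed now, and g serves to complete them after the pinching. -/
theorem exists_forestSystem_odd {d : α} : ∀ (n : ℕ) (V : Finset α)
    (M : FinMultigraph α β), V.card + M.edges.card = n → M.EndsIn V → d ∈ V →
    M.CutCondition V (2 * m + 1) →
    ∃ D q r, IsForestSystem (m := m) M V d D q r ∧ ∀ i, ∀ v ∈ V, v ≠ d → q i v ≠ none := by
  intro n
  induction n using Nat.strong_induction_on with
  | _ n ih =>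
  intro V M hn hM hd hc
  by_cases hdel : ∃ g ∈ M.edges, (M.eraseEdge g).CutCondition V (2 * m + 1)
  · obtain ⟨g, hg, hgc⟩ := hdel
    obtain ⟨D, q, r, S, h2⟩ := ih _ (by
      have : (M.eraseEdge g).edges.card < M.edges.card := Finset.card_erase_lt_of_mem hg
      omega) V (M.eraseEdge g) rfl (hM.eraseEdge g) hd hgc
    obtain ⟨D', S', -⟩ := S.addEdge (x := M.fst g) (y := M.snd g) ⟨hg, Or.inl ⟨rfl, rfl⟩⟩ true
    exact ⟨D', q, r, S', h2⟩
  push Not at hdel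
  by_cases hV : ∀ v ∈ V, v = d
  · obtain ⟨D, r, S⟩ := M.exists_empty_forestSystem V d m
    exact ⟨D, _, r, S, fun i v hv hvd => absurd (hV v hv) hvd⟩
  push Not at hV
  obtain ⟨v, hv, hvd⟩ := hV
  have hmin : ∀ g ∈ M.edges, ∃ X, M.IsTight V d (2 * m + 1) X ∧
      cross (M.fst g) (M.snd g) X = 1 := fun g hg => hc.exists_isTight hM hg (hdel g hg)
  obtain ⟨g, hg, hsing⟩ := hc.exists_edge_tight_singleton hd ⟨m, rfl⟩
    (hc.edges_nonempty (by omega) hv hvd hd)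
  obtain ⟨z, w, hgl, hz, hzw⟩ : ∃ z w, M.Links g z w ∧ M.IsTight V d (2 * m + 1) {z} ∧ z ≠ w := by
    obtain ⟨X, hX, hcr⟩ := hmin g hg
    obtain ⟨z, rfl⟩ := Finset.card_eq_one.1 (hsing X hX hcr)
    simp only [cross, Finset.mem_singleton] at hcr
    by_cases h : M.fst g = z
    · exact ⟨z, M.snd g, ⟨hg, Or.inl ⟨h, rfl⟩⟩, hX, by grind⟩
    · exact ⟨z, M.fst g, ⟨hg, Or.inr ⟨rfl, by grind⟩⟩, hX, by grind⟩
  have hzV : z ∈ V := hz.subset (Finset.mem_singleton_self z)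
  have hwV : w ∈ V := hgl.mem_right hM
  have hzd : z ≠ d := by
    rintro rfl
    exact hz.notMem (Finset.mem_singleton_self _)
  have hdV : d ∈ V.erase z := Finset.mem_erase.2 ⟨hzd.symm, hd⟩
  have hdegz : (M.eraseEdge g).cut {z} = 2 * m := by
    have h1 := M.cut_eraseEdge hg {z}
    rw [(hgl.cross_eq_one_iff {z}).2 (by simp [hzw.symm]), hz.cut_eq] at h1
    omega
  have hsubV : ∀ X ⊆ V.erase z, X ⊆ V ∧ X ≠ V := fun X hX =>
    ⟨hX.trans (Finset.erase_subset _ _), fun h => Finset.notMem_erase z V (hX (h ▸ hzV))⟩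
  -- a cut of the smaller graph which is crossed by `g` has the vertex `w` on its side
  have hbig : ∀ X ⊆ V.erase z, X.Nonempty → X ≠ V.erase z →
      (X = {w} → ¬ M.IsTight V d (2 * m + 1) {w}) → 2 * m + 1 ≤ (M.eraseEdge g).cut X := by
    intro X hX hXn hXV hXw
    have hzX : z ∉ X := fun h => Finset.notMem_erase z V (hX h)
    refine hc.le_cut_eraseEdge hM hg hsing (hsubV X hX).1 hXn (hsubV X hX).2 (fun h => ?_)
      (fun _ => Or.inl fun h => ?_)
    · by_cases h1 : X.card = 1
      · obtain ⟨x, rfl⟩ := Finset.card_eq_one.1 h1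
        right
        rw [hgl.cross_eq_one_iff] at h
        have hxw : w = x := by
          by_contra hwx
          simp [hwx] at h
          exact hzX (by simp [h])
        subst hxw
        exact hXw rfl
      · exact Or.inl h1
    · obtain ⟨x, hx⟩ := Finset.card_eq_one.1 h
      have hzx : z = x := by
        have : z ∈ V \ X := Finset.mem_sdiff.2 ⟨hzV, hzX⟩
        rw [hx] at this
        simpa using this
      apply hXV
      rw [hzx, ← Finset.sdiff_singleton_eq_erase, ← hx, Finset.sdiff_sdiff_eq_self (hsubV X hX).1]
  have hNV : (M.eraseEdge g).EndsIn (insert z (V.erase z)) := by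
    rw [Finset.insert_erase hzV]
    exact hM.eraseEdge g
  by_cases hw : M.IsTight V d (2 * m + 1) {w}
  · have hwd : w ≠ d := by
      rintro rfl
      exact hw.notMem (Finset.mem_singleton_self _)
    have hwV₁ : w ∈ V.erase z := Finset.mem_erase.2 ⟨hzw.symm, hwV⟩
    have hdV₂ : d ∈ (V.erase z).erase w := Finset.mem_erase.2 ⟨hwd.symm, hdV⟩
    have hdegw : (M.eraseEdge g).cut {w} = 2 * m := by
      have h1 := M.cut_eraseEdge hg {w}
      rw [(hgl.cross_eq_one_iff {w}).2 (by simp [hzw]), hw.cut_eq] at h1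
      omega
    have hpair : 2 * m + 1 ≤ M.cut {z, w} := by
      refine hc.le_cut hd (Finset.insert_subset hzV (Finset.singleton_subset_iff.2 hwV)) ?_ (by simp)
      simp [hzd.symm, hwd.symm]
    -- Twice the number of edges between z and w is 2(2m + 1) minus the cut of {z, w}, hence at most
    -- 2m + 1.
    have hpar : (M.parallel z w).card ≤ m := by
      have h1 := M.cut_singleton_add hzw
      rw [hz.cut_eq, hw.cut_eq] at h1
      omega
    -- Without g the degree of w is 2m, so the bound is lowered by one for {w} and for its
    -- complement in V \ {z}.
    let R : Finset α → ℕ := fun X =>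
      if X = {w} ∨ X = (V.erase z).erase w then 2 * m else 2 * m + 1
    have hwne : ({w} : Finset α) ≠ V.erase z := by
      intro h
      rw [← h, Finset.mem_singleton] at hdV
      exact hwd hdV.symm
    obtain ⟨H₁, P₁, f₁, hS₁, hH₁⟩ := exists_completeSplitting (Finset.notMem_erase z V) (2 * m + 1)
      R (fun X => by simp only [R]; split_ifs <;> omega)
      (fun X hX => by
        have h1 : V.erase z \ X = {w} ↔ X = (V.erase z).erase w := by
          constructor
          · intro h
            rw [← Finset.sdiff_singleton_eq_erase, ← h, Finset.sdiff_sdiff_eq_self hX]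
          · rintro rfl
            rw [Finset.sdiff_erase_self hwV₁]
        have h2 : V.erase z \ X = (V.erase z).erase w ↔ X = {w} := by
          constructor
          · intro h
            rw [← Finset.sdiff_sdiff_eq_self hX, h, Finset.sdiff_erase_self hwV₁]
          · rintro rfl
            rw [Finset.sdiff_singleton_eq_erase]
        simp only [R, h1, h2, or_comm])
      m (fun hm => exceptional_sum_gt hm R (fun X => rfl)) (M.eraseEdge g) hNV
      (fun X hX hXn hXV => by
        simp only [R]
        split_ifs with h
        · by_cases hXw : X = {w}
          · rw [hXw, hdegw]
          · exact (Nat.le_succ _).trans (hbig X hX hXn hXV fun h => absurd h hXw)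
        · exact hbig X hX hXn hXV fun h' => absurd (Or.inl h') h)
      hdegz
    -- The splitting keeps the lowered bound and does not increase cuts, so w has exactly the degree
    -- needed for its own splitting.
    have hdegw₁ : H₁.cut {w} = 2 * m := by
      have h1 := hH₁ {w} (by simpa using hwV₁) (by simp) hwne
      have h2 := hS₁.cut_le {w} (by simpa using hwV₁)
      simp only [R, true_or, if_true] at h1
      omega
    obtain ⟨H₂, P₂, f₂, hS₂, hH₂⟩ := exists_completeSplitting
      (Finset.notMem_erase w (V.erase z)) (2 * m + 1)
      (fun _ => 2 * m + 1) (fun _ => le_rfl) (fun _ _ => rfl) m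
      (fun hm _ _ _ _ _ _ _ _ _ _ _ _ _ _ _ _ _ _ => four_mul_gt (Or.inr rfl) hm) H₁
      (by rw [Finset.insert_erase hwV₁]; exact hS₁.endsIn)
      -- The sets with lowered bound do not matter here: X omits w and is not all of V \ {z, w}.
      (fun X hX hXn hXV => by
        have hwX : w ∉ X := fun h => Finset.notMem_erase w _ (hX h)
        have h1 := hH₁ X (hX.trans (Finset.erase_subset _ _)) hXn (by
          rintro rfl
          exact hwX hwV₁)
        simp only [R] at h1
        rwa [if_neg] at h1
        rintro (rfl | h)
        · exact hwX (by simp)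
        · exact hXV h) hdegw₁
    obtain ⟨D, q, r, S, hcomp⟩ := ih _ (hn ▸ card_erase_add_lt hzV (Finset.erase_subset _ _)
      (hS₂.edges_subset.trans (hS₁.edges_subset.trans (Finset.erase_subset _ _))))
      ((V.erase z).erase w) H₂ rfl hS₂.endsIn hdV₂ hH₂
    obtain ⟨D₁, q₁, r₁, i, S₁, hA₁, hB₁, hC₁, hD₁, hE₁, hF₁⟩ :=
      S.exists_pinch (Finset.notMem_erase w _) hwd hS₂ hdegw₁
    rw [Finset.insert_erase hwV₁] at S₁
    obtain ⟨D₂, q₂, r₂, j, S₂, hA₂, hB₂, hC₂, hD₂, hE₂, hF₂⟩ :=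
      S₁.exists_pinch (Finset.notMem_erase z _) hzd hS₁ hdegz
    rw [Finset.insert_erase hzV] at S₂
    refine S₂.exists_complete_of_two_missing hzV hzd hwV hwd hzw hgl hpar ?_
      ((hA₂ i w hzw.symm).2 ((hB₁ i).2 rfl)) ((hB₂ j).2 rfl) hD₂ ?_ ?_
      (fun c k h => (hE₂ c k h).2) ?_
    · intro i' v hv hvd h
      by_cases hvz : v = z
      · subst hvz
        exact Or.inr ⟨(hB₂ i').1 h, rfl⟩
      rw [hA₂ _ _ hvz] at h
      by_cases hvw : v = w
      · subst hvw
        exact Or.inl ⟨(hB₁ i').1 h, rfl⟩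
      rw [hA₁ _ _ hvw] at h
      exact absurd h (hcomp i' v (Finset.mem_erase.2 ⟨hvw, Finset.mem_erase.2 ⟨hvz, hv⟩⟩) hvd)
    -- Pinching z changes heads of arcs at other vertices only to z, and i did not enter w before;
    -- so in i only z can now have an arc to w.
    · intro v e hvz h
      have h1 : q₁ i v ≠ none := fun h1 => by
        rw [(hA₂ i v hvz).2 h1] at h
        cases h
      obtain ⟨⟨e', y⟩, h2⟩ := Option.ne_none_iff_exists'.1 h1
      obtain ⟨e'', y', h3, h4, -⟩ := hC₂ i v e' y hvz h2
      rw [h3] at h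
      simp only [Option.some.injEq, Prod.mk.injEq] at h
      rcases h4 with h4 | h4
      · rw [← h4, h.2] at h2
        exact hD₁ _ _ h2
      · exact hzw (h4.symm.trans h.2)
    · intro e h
      rcases hF₂ i e w h with ⟨v, e', h1⟩ | h1
      · exact absurd h1 (hD₁ v e')
      · exact h1
    · intro c k h
      obtain ⟨e, y, h1, h2⟩ := (hE₁ c k h).2
      obtain ⟨e', y', h3, -, h4⟩ := hC₂ none w e y hzw.symm h1
      exact ⟨e', y', h3, h4 c h2⟩
  -- When {w} is not tight, the full bound survives the deletion of g away from z.
  · obtain ⟨H, P, f, hS, hH⟩ := exists_completeSplitting (Finset.notMem_erase z V) (2 * m + 1)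
      (fun _ => 2 * m + 1) (fun _ => le_rfl) (fun _ _ => rfl) m
      (fun hm _ _ _ _ _ _ _ _ _ _ _ _ _ _ _ _ _ _ => four_mul_gt (Or.inr rfl) hm)
      (M.eraseEdge g) hNV (fun X hX hXn hXV => hbig X hX hXn hXV fun _ => hw) hdegz
    obtain ⟨D, q, r, S, hcomp⟩ := ih _ (hn ▸ card_erase_add_lt hzV subset_rfl
      (hS.edges_subset.trans (Finset.erase_subset _ _))) (V.erase z) H rfl hS.endsIn hdV hH
    obtain ⟨D', q', r', i₀, S', hA, hB, -, hD, -, -⟩ :=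
      S.exists_pinch (Finset.notMem_erase z V) hzd hS hdegz
    rw [Finset.insert_erase hzV] at S'
    refine S'.exists_complete_of_one_missing hzV hzd hwV hgl hzw hD fun i v hv hvd h => ?_
    by_cases hvz : v = z
    · subst hvz
      exact ⟨(hB i).1 h, rfl⟩
    · rw [hA _ _ hvz] at h
      exact absurd h (hcomp i v (Finset.mem_erase.2 ⟨hvz, hv⟩) hvd)

/-! ### From forest systems to arborescences, and from paths to cuts -/

namespace IsForestSystem

variable {G : Graph α β} {M : FinMultigraph α β} {V : Finset α} {d : α} {D : Bool → β → α}
  {q : Option (Bool × Fin m) → α → Option (β × α)} {r : Option (Bool × Fin m) → α → ℕ}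

/-- The forest `i` of a system, as a spanning subgraph of the directed copy of `G`. -/
def toDiSubgraph (S : IsForestSystem M V d D q r) (hV : ∀ v, v ∈ V ↔ v ∈ G.vertexSet)
    (hG : ∀ e x y, M.Links e x y → G.IsLink e x y) (i : Option (Bool × Fin m)) : G.DiSubgraph where
  verts := G.vertexSet
  arcs := {a | q i a.tail = some (a.edge, a.head)}
  verts_subset := subset_rfl
  arcs_subset _ ha := hG _ _ _ (S.links ha)
  tail_mem _ ha := (hV _).1 (S.mem ha)
  head_mem _ ha := (hV _).1 (S.head_mem ha)

theorem isSpanningArborescence (S : IsForestSystem M V d D q r)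
    (hV : ∀ v, v ∈ V ↔ v ∈ G.vertexSet) (hG : ∀ e x y, M.Links e x y → G.IsLink e x y)
    (hd : d ∈ G.vertexSet) {i : Option (Bool × Fin m)} (hi : ∀ v ∈ V, v ≠ d → q i v ≠ none) :
    (S.toDiSubgraph hV hG i).IsSpanningArborescence d := by
  refine ⟨⟨hd, fun v hv => ⟨fun h => ?_, ?_⟩, fun v hv hne => ?_⟩, rfl⟩
  · by_contra hvd
    obtain ⟨⟨e, y⟩, h'⟩ := Option.ne_none_iff_exists'.1 (hi v ((hV v).2 hv) hvd)
    exact h ⟨e, v, y⟩ h' rfl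
  · rintro rfl a ha rfl
    exact S.ne_root ha rfl
  -- The claim is proved for the root too, where the empty walk is the only one because no arc
  -- leaves d. This makes the induction on the rank uniform.
  · clear hne
    induction hn : r i v using Nat.strong_induction_on generalizing v with
    | _ n ih =>
    by_cases hvd : v = d
    · subst hvd
      refine ⟨[], rfl, fun p hp => ?_⟩
      cases p with
      | nil => rfl
      | cons a p =>
        obtain ⟨ha, h1, -⟩ := hp
        exact absurd h1 (S.ne_root ha)
    · obtain ⟨⟨e, y⟩, h⟩ := Option.ne_none_iff_exists'.1 (hi v ((hV v).2 hv) hvd)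
      obtain ⟨p, hp, huniq⟩ := ih _ (hn ▸ S.rank_lt h) y ((hV y).1 (S.head_mem h)) rfl
      refine ⟨⟨e, v, y⟩ :: p, ⟨h, rfl, hp⟩, fun p' hp' => ?_⟩
      cases p' with
      | nil => exact absurd hp' hvd
      | cons a p' =>
        obtain ⟨ha, rfl, h2⟩ := hp'
        have ha' : q i a.tail = some (a.edge, a.head) := ha
        rw [h] at ha'
        simp only [Option.some.injEq, Prod.mk.injEq] at ha'
        obtain ⟨rfl, rfl⟩ := ha'
        rw [huniq p' h2]

theorem arcDisjoint (S : IsForestSystem M V d D q r)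
    (hV : ∀ v, v ∈ V ↔ v ∈ G.vertexSet) (hG : ∀ e x y, M.Links e x y → G.IsLink e x y)
    {i j : Option (Bool × Fin m)} (hij : i ≠ j) :
    (S.toDiSubgraph hV hG i).ArcDisjoint (S.toDiSubgraph hV hG j) :=
  fun _ ha ha' => hij (S.disj ha ha')

/-- Using an edge in both directions within one kind would make its prescribed tail equal to both
ends of an arc. -/
theorem shareNoEdge (S : IsForestSystem M V d D q r)
    (hV : ∀ v, v ∈ V ↔ v ∈ G.vertexSet) (hG : ∀ e x y, M.Links e x y → G.IsLink e x y)
    (c : Bool) (k l : Fin m) :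
    (S.toDiSubgraph hV hG (some (c, k))).ShareNoEdge (S.toDiSubgraph hV hG (some (c, l))) :=
  fun _ ha ha' => S.ne ha ((S.orient ha).symm.trans (S.orient ha'))

end IsForestSystem

/-- A walk which leaves `X` has an arc which leaves `X`. -/
theorem exists_mem_leaving {A : Set (Graph.Arc α β)} {X : Finset α} {y : α} (hy : y ∉ X) :
    ∀ (p : List (Graph.Arc α β)) (x : α), x ∈ X → Graph.IsDiWalk A x p y →
      ∃ a ∈ p, a ∈ A ∧ a.tail ∈ X ∧ a.head ∉ X := by
  intro p
  induction p with
  | nil =>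
    intro x hx h
    exact absurd (show x = y from h) (by rintro rfl; exact hy hx)
  | cons a p ih =>
    rintro x hx ⟨ha, rfl, hp⟩
    by_cases h : a.head ∈ X
    · obtain ⟨b, hb, h'⟩ := ih _ h hp
      exact ⟨b, List.mem_cons_of_mem _ hb, h'⟩
    · exact ⟨a, List.mem_cons_self, ha, hx, h⟩

/-- The easy direction of Menger's theorem: each of k edge-disjoint paths from X to its complement
leaves X along an edge of its own. -/
theorem cutCondition_of_isEdgeConnected {G : Graph α β} {M : FinMultigraph α β} {V : Finset α}
    {k : ℕ} (hV : ∀ v, v ∈ V ↔ v ∈ G.vertexSet) (hG : ∀ e x y, G.IsLink e x y → M.Links e x y)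
    (hk : G.IsEdgeConnected k) : M.CutCondition V k := by
  intro X hX ⟨x, hx⟩ hXV
  obtain ⟨y, hy, hyX⟩ : ∃ y ∈ V, y ∉ X := by
    by_contra! h
    exact hXV (hX.antisymm h)
  obtain ⟨P, hP, hdisj⟩ := hk x ((hV x).1 (hX hx)) y ((hV y).1 hy) (by rintro rfl; exact hyX hx)
  have h : ∀ i, ∃ a ∈ P i, a ∈ G.arcSet ∧ a.tail ∈ X ∧ a.head ∉ X := fun i =>
    exists_mem_leaving hyX (P i) x hx (hP i).1
  choose a ha haG hat hah using h
  have hl : ∀ i, M.Links (a i).edge (a i).tail (a i).head := fun i => hG _ _ _ (haG i)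
  have hcut : M.cut X = (M.edges.filter fun e => cross (M.fst e) (M.snd e) X = 1).card := by
    rw [cut, Finset.card_filter]
    refine Finset.sum_congr rfl fun e _ => ?_
    unfold cross
    split_ifs <;> simp_all
  rw [hcut, ← Fintype.card_fin k, ← Finset.card_univ]
  refine Finset.card_le_card_of_injOn (fun i => (a i).edge) (fun i _ => ?_) fun i _ j _ hij => ?_
  · rw [Finset.mem_coe, Finset.mem_filter, (hl i).cross_eq_one_iff]
    exact ⟨(hl i).1, fun h => hah i (h.1 (hat i))⟩
  · by_contra hne
    exact hdisj i j hne (List.mem_map_of_mem (ha i)) (by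
      rw [show (a i).edge = (a j).edge from hij]
      exact List.mem_map_of_mem (ha j))

/-- The forests of a system in order: first the `m` forests of the first kind, then those of the
second kind. -/
def forestIndex (m i : ℕ) : Option (Bool × Fin m) :=
  if h : i < m then some (true, ⟨i, h⟩)
  else if h' : i - m < m then some (false, ⟨i - m, h'⟩) else none

theorem forestIndex_of_lt {i : ℕ} (h : i < m) : forestIndex m i = some (true, ⟨i, h⟩) :=
  dif_pos h

theorem forestIndex_of_le {i : ℕ} (h : m ≤ i) (h' : i < 2 * m) :
    forestIndex m i = some (false, ⟨i - m, by omega⟩) := by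
  rw [forestIndex, dif_neg (by omega), dif_pos (by omega)]

theorem forestIndex_injOn {i j : ℕ} (hi : i < 2 * m + 1) (hj : j < 2 * m + 1)
    (h : forestIndex m i = forestIndex m j) : i = j := by
  unfold forestIndex at h
  split_ifs at h <;> simp at h <;> omega

theorem exists_arborescences {G : Graph α β} {M : FinMultigraph α β} {V : Finset α} {d : α} {k : ℕ}
    (hV : ∀ v, v ∈ V ↔ v ∈ G.vertexSet) (hG : ∀ e x y, G.IsLink e x y ↔ M.Links e x y)
    (hM : M.EndsIn V) (hd : d ∈ G.vertexSet) (hk : 1 ≤ k) (hc : M.CutCondition V k) :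
    ∃ T : Fin k → G.DiSubgraph,
      (∀ i, (T i).IsSpanningArborescence d) ∧
      (∀ i j, i ≠ j → (T i).ArcDisjoint (T j)) ∧
      (∀ i j : Fin k, i ≠ j → (i : ℕ) < k / 2 → (j : ℕ) < k / 2 →
        (T i).ShareNoEdge (T j)) ∧
      (∀ i j : Fin k, i ≠ j → k / 2 ≤ (i : ℕ) → (i : ℕ) < 2 * (k / 2) →
        k / 2 ≤ (j : ℕ) → (j : ℕ) < 2 * (k / 2) →
        (T i).ShareNoEdge (T j)) := by
  have hdV := (hV d).2 hd
  obtain ⟨D, q, r, S, hcomp⟩ : ∃ D q r, IsForestSystem (m := k / 2) M V d D q r ∧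
      ∀ i : Fin k, ∀ v ∈ V, v ≠ d → q (forestIndex (k / 2) i) v ≠ none := by
    rcases Nat.even_or_odd' k with ⟨m, hm | hm⟩
    · have h2 : k / 2 = m := by omega
      rw [h2]
      obtain ⟨D, q, r, S, -, h⟩ := exists_forestSystem_even (m := m) (by omega) _ V M rfl hM hdV
        (hm ▸ hc)
      refine ⟨D, q, r, S, fun i => h _ ?_⟩
      rcases lt_or_ge (i : ℕ) m with h1 | h1
      · simp [forestIndex_of_lt h1]
      · simp [forestIndex_of_le h1 (by omega)]
    · have h2 : k / 2 = m := by omega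
      rw [h2]
      obtain ⟨D, q, r, S, h⟩ := exists_forestSystem_odd (m := m) _ V M rfl hM hdV (hm ▸ hc)
      exact ⟨D, q, r, S, fun i => h _⟩
  have hG' : ∀ e x y, M.Links e x y → G.IsLink e x y := fun e x y h => (hG e x y).2 h
  refine ⟨fun i => S.toDiSubgraph hV hG' (forestIndex (k / 2) i),
    fun i => S.isSpanningArborescence hV hG' hd (hcomp i), fun i j hij => ?_,
    fun i j _ hi hj => ?_, fun i j _ hi hi' hj hj' => ?_⟩
  · refine S.arcDisjoint hV hG' fun h => hij (Fin.ext (forestIndex_injOn ?_ ?_ h)) <;> omega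
  · beta_reduce
    rw [forestIndex_of_lt hi, forestIndex_of_lt hj]
    exact S.shareNoEdge hV hG' _ _ _
  · beta_reduce
    rw [forestIndex_of_le hi hi', forestIndex_of_le hj hj']
    exact S.shareNoEdge hV hG' _ _ _

theorem exists_eq_links (G : Graph α β) (hE : G.edgeSet.Finite) (d : α) :
    ∃ M : FinMultigraph α β, ∀ e x y, G.IsLink e x y ↔ M.Links e x y := by
  have : Nonempty α := ⟨d⟩
  have h : ∀ e ∈ G.edgeSet, ∃ x y, G.IsLink e x y := fun e he =>
    G.exists_isLink_of_mem_edgeSet he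
  choose! s t hst using h
  refine ⟨⟨hE.toFinset, s, t⟩, fun e x y => ⟨fun hl => ?_, ?_⟩⟩
  · have he := hl.edge_mem
    exact ⟨hE.mem_toFinset.2 he, (hst e he).eq_and_eq_or_eq_and_eq hl⟩
  · rintro ⟨he, ⟨rfl, rfl⟩ | ⟨rfl, rfl⟩⟩
    · exact hst e (hE.mem_toFinset.1 he)
    · exact (hst e (hE.mem_toFinset.1 he)).symm

end FinMultigraph

theorem mainTheorem9 {α β : Type*} (G : Graph α β)
    (hV : G.vertexSet.Finite) (hE : G.edgeSet.Finite)
    (k : ℕ) (hk : 1 ≤ k) (hG : G.IsEdgeConnected k)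
    (d : α) (hd : d ∈ G.vertexSet) :
    ∃ T : Fin k → G.DiSubgraph,
      (∀ i, (T i).IsSpanningArborescence d) ∧
      (∀ i j, i ≠ j → (T i).ArcDisjoint (T j)) ∧
      (∀ i j : Fin k, i ≠ j → (i : ℕ) < k / 2 → (j : ℕ) < k / 2 →
        (T i).ShareNoEdge (T j)) ∧
      (∀ i j : Fin k, i ≠ j → k / 2 ≤ (i : ℕ) → (i : ℕ) < 2 * (k / 2) →
        k / 2 ≤ (j : ℕ) → (j : ℕ) < 2 * (k / 2) →
        (T i).ShareNoEdge (T j)) := by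
  classical
  have hV' : ∀ v, v ∈ hV.toFinset ↔ v ∈ G.vertexSet := fun v => hV.mem_toFinset
  obtain ⟨M, hM⟩ := FinMultigraph.exists_eq_links G hE d
  refine FinMultigraph.exists_arborescences hV' hM (fun e he => ?_) hd hk
    (FinMultigraph.cutCondition_of_isEdgeConnected hV' (fun e x y h => (hM e x y).1 h) hG)
  have hl : G.IsLink e (M.fst e) (M.snd e) := (hM _ _ _).2 ⟨he, Or.inl ⟨rfl, rfl⟩⟩
  exact ⟨(hV' _).2 hl.left_mem, (hV' _).2 hl.right_mem⟩
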